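/- An mm-space is a complete separable metric space $(X,d_X)$ with a Borel probability measure $\mu_X$; we always assume $X=\operatorname{supp}\mu_X$, a general triple $(X,d_X,\mu_X)$ being identified with $(\operatorname{supp}\mu_X,d_X,\mu_X)$. Let $\mathcal X$ be the set of mm-isomorphism classes of mm-spaces, where an mm-isomorphism is an isometry pushing one measure forward to the other. Write $X\prec Y$ if there is a $1$-Lipschitz map $f:Y\to X$ with $f_*\mu_Y=\mu_X$. Let $I=[0,1)$ with Lebesgue measure $\mathcal L^1$; a parameter of $X$ is a Borel map $\varphi:I\to X$ with $\varphi_*\mathcal L^1=\mu_X$. The box distance $\square(X,Y)$ is the infimum of the $\varepsilon\ge 0$ for which there are parameters $\varphi$ of $X$ and $\psi$ of $Y$ and a Borel set $I_0\subset I$ with $\mathcal L^1(I_0)\ge 1-\varepsilon$ and $|d_X(\varphi(s),\varphi(t))-d_Y(\psi(s),\psi(t))|\le\varepsilon$ for all $s,t\in I_0$. For $X\in\mathcal X$ and $\mathcal A\subset\mathcal X$ put $\square(X,\mathcal A)=\inf_{Y\in\mathcal A}\square(X,Y)$. A pyramid is a nonempty $\square$-closed subset $\mathcal P\subset\mathcal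 X$ such that (i) $X\in\mathcal P$ and $Y\prec X$ imply $Y\in\mathcal P$, and (ii) for all $X,X'\in\mathcal P$ there is $Y\in\mathcal P$ with $X\prec Y$ and $X'\prec Y$. Let $\Pi$ be the set of pyramids. A sequence $\mathcal P_n\in\Pi$ converges weakly to $\mathcal P\in\Pi$ if $\lim_{n\to\infty}\square(X,\mathcal P_n)=0$ for every $X\in\mathcal P$ and $\liminf_{n\to\infty}\square(X,\mathcal P_n)>0$ for every $X\in\mathcal X\setminus\mathcal P$. For a natural number $N$ and a real number $R\ge 0$ let $\mathcal X(N,R)\subset\mathcal X$ be the set of classes of $(B^N_R,\|\cdot\|_\infty,\mu)$, where $B^N_R=\{x\in\mathbb R^N:\|x\|_\infty\le R\}$ and $\mu$ is a Borel probability measure on $\mathbb R^N$ with $\operatorname{supp}\mu\subset B^N_R$. With $d_H$ the Hausdorff distance induced from $\square$, define for $\mathcal P,\mathcal P'\in\Pi$ $$\rho(\mathcal P,\mathcal P')=\sum_{k=1}^\infty 2^{-k}\,\frac1{4k}\,d_H\bigl(\mathcal P\cap\mathcal X(k,k),\,\mathcal P'\cap\mathcal X(k,k)\bigr).$$ Proposition.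 $\rho$ is a (finite-valued) metric on $\Pi$. It is compatible with weak convergence: a sequence $\mathcal P_n\in\Pi$ converges weakly to $\mathcal P\in\Pi$ if and only if $\mathcal P_n\to\mathcal P$ with respect to $\rho$. Moreover, $\Pi$ is compact with respect to $\rho$. -/

import Mathlib

open MeasureTheory Set Filter Topology
open scoped ENNReal NNReal

/-- An mm-space: a complete separable metric space with a Borel probability measure whose support
is the whole space. -/
structure MMSpace : Type 1 where
  carrier : Type
  [metricSpace : MetricSpace carrier]
  [completeSpace : CompleteSpace carrier]
  [separableSpace : TopologicalSpace.SeparableSpace carrier]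
  [measurableSpace : MeasurableSpace carrier]
  [borelSpace : BorelSpace carrier]
  μ : Measure carrier
  [isProbabilityMeasure : IsProbabilityMeasure μ]
  support_eq : μ.support = Set.univ

namespace MMSpace

instance : CoeSort MMSpace Type := ⟨MMSpace.carrier⟩

attribute [instance] metricSpace completeSpace separableSpace measurableSpace borelSpace
  isProbabilityMeasure

/-- The mm-space `(supp μ, d, μ)` of a Borel probability measure `μ` on a complete separable
metric space; it is the representative with full support of `(E, d, μ)`. -/
noncomputable def ofMeasure {E : Type} [MetricSpace E] [CompleteSpace E]
    [TopologicalSpace.SeparableSpace E] [MeasurableSpace E] [BorelSpace E]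
    (μ : Measure E) [IsProbabilityMeasure μ] : MMSpace :=
  haveI : SecondCountableTopology E := UniformSpace.secondCountable_of_separable E
  haveI hm : MeasurableSet μ.support := μ.isClosed_support.measurableSet
  { carrier := μ.support
    completeSpace := μ.isClosed_support.completeSpace_coe
    separableSpace := inferInstance
    μ := μ.comap Subtype.val
    isProbabilityMeasure := by
      refine ⟨?_⟩
      rw [comap_subtype_coe_apply hm, Set.image_univ, Subtype.range_coe,
        measure_congr (eventuallyEq_univ.2 μ.support_mem_ae), measure_univ]
    support_eq := by
      refine Set.eq_univ_of_forall fun x => ?_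
      rw [Measure.mem_support_iff_forall]
      intro U hU
      obtain ⟨V, hV, hVU⟩ := mem_nhds_subtype _ x U |>.1 hU
      refine lt_of_lt_of_le ?_ (measure_mono hVU)
      rw [comap_subtype_coe_apply hm, Subtype.image_preimage_coe, Set.inter_comm,
        measure_congr ((Filter.EventuallyEq.refl _ V).inter
          (eventuallyEq_univ.2 μ.support_mem_ae)), Set.inter_univ]
      exact ((Measure.mem_support_iff_forall _).1 x.2) V hV }

/-- `X` and `Y` are mm-isomorphic. -/
def Iso (X Y : MMSpace) : Prop :=
  ∃ f : X → Y, Isometry f ∧ X.μ.map f = Y.μ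

/-- The Lipschitz order: `X ≺ Y`, that is, `Y` dominates `X`. -/
def Prec (X Y : MMSpace) : Prop :=
  ∃ f : Y → X, LipschitzWith 1 f ∧ Y.μ.map f = X.μ

theorem Iso.refl (X : MMSpace) : X.Iso X := ⟨id, isometry_id, Measure.map_id⟩

theorem Iso.trans {X Y Z : MMSpace} : X.Iso Y → Y.Iso Z → X.Iso Z := by
  rintro ⟨f, hf, hf'⟩ ⟨g, hg, hg'⟩
  refine ⟨g ∘ f, hg.comp hf, ?_⟩
  rw [← Measure.map_map hg.continuous.measurable hf.continuous.measurable, hf', hg']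

theorem Iso.symm {X Y : MMSpace} : X.Iso Y → Y.Iso X := by
  rintro ⟨f, hf, hf'⟩
  have hm := hf.continuous.measurable
  have hcl : IsClosed (Set.range f) := hf.isClosedEmbedding.isClosed_range
  have hsurj : Function.Surjective f := by
    intro y
    by_contra hy
    have hy' : (Set.range f)ᶜ ∈ 𝓝 y := hcl.isOpen_compl.mem_nhds hy
    have hys : y ∈ Y.μ.support := by rw [Y.support_eq]; trivial
    have hpos := (Measure.mem_support_iff_forall _).1 hys _ hy'
    rw [← hf', Measure.map_apply hm hcl.measurableSet.compl] at hpos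
    have he : f ⁻¹' (Set.range f)ᶜ = ∅ := by ext x; simp
    simp [he] at hpos
  obtain ⟨g, hg⟩ := hsurj.hasRightInverse
  have hgi : Isometry g := fun a b => by rw [← hf.edist_eq, hg a, hg b]
  have hgf : g ∘ f = id := by
    funext x
    exact hf.injective (hg (f x))
  refine ⟨g, hgi, ?_⟩
  rw [← hf', Measure.map_map hgi.continuous.measurable hm, hgf, Measure.map_id]

theorem Iso.prec {X Y : MMSpace} (h : X.Iso Y) : Y.Prec X := by
  obtain ⟨f, hf, hf'⟩ := h
  exact ⟨f, hf.lipschitz, hf'⟩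

theorem Prec.trans {X Y Z : MMSpace} : X.Prec Y → Y.Prec Z → X.Prec Z := by
  rintro ⟨f, hf, hf'⟩ ⟨g, hg, hg'⟩
  refine ⟨f ∘ g, by simpa using hf.comp hg, ?_⟩
  rw [← Measure.map_map hf.continuous.measurable hg.continuous.measurable, hg', hf']

/-- The Lebesgue measure of the interval `[0,1)`. -/
noncomputable def lebesgueIco : Measure (Set.Ico (0 : ℝ) 1) :=
  (volume : Measure ℝ).comap Subtype.val

/-- `φ : [0,1) → X` is a parameter of `X`: it is Borel measurable and pushes the Lebesgue measure
of `[0,1)` forward to `μ_X`. -/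
def IsParameter (X : MMSpace) (φ : Set.Ico (0 : ℝ) 1 → X) : Prop :=
  Measurable φ ∧ lebesgueIco.map φ = X.μ

/-- `ε` is admissible in the definition of the box distance between `X` and `Y`. -/
def BoxAdmissible (X Y : MMSpace) (ε : ℝ≥0) : Prop :=
  ∃ (φ : Set.Ico (0 : ℝ) 1 → X) (ψ : Set.Ico (0 : ℝ) 1 → Y) (I₀ : Set (Set.Ico (0 : ℝ) 1)),
    X.IsParameter φ ∧ Y.IsParameter ψ ∧ MeasurableSet I₀ ∧
    (∀ s ∈ I₀, ∀ t ∈ I₀, |dist (φ s) (φ t) - dist (ψ s) (ψ t)| ≤ (ε : ℝ)) ∧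
    (1 : ℝ) - (ε : ℝ) ≤ lebesgueIco.real I₀

/-- The box distance, as an infimum in `[0,∞]`. -/
noncomputable def box (X Y : MMSpace) : ℝ≥0∞ :=
  ⨅ (ε : ℝ≥0) (_ : BoxAdmissible X Y ε), (ε : ℝ≥0∞)

theorem IsParameter.comp {X Y : MMSpace} {φ : Set.Ico (0 : ℝ) 1 → X} (h : X.IsParameter φ)
    {f : X → Y} (hf : Isometry f) (hf' : X.μ.map f = Y.μ) : Y.IsParameter (f ∘ φ) :=
  ⟨hf.continuous.measurable.comp h.1, by
    rw [← Measure.map_map hf.continuous.measurable h.1, h.2, hf']⟩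

theorem BoxAdmissible.congr {X Y X' Y' : MMSpace} (hX : X.Iso X') (hY : Y.Iso Y') {ε : ℝ≥0}
    (h : BoxAdmissible X Y ε) : BoxAdmissible X' Y' ε := by
  obtain ⟨f, hf, hf'⟩ := hX
  obtain ⟨g, hg, hg'⟩ := hY
  obtain ⟨φ, ψ, I₀, hφ, hψ, hI, hd, hv⟩ := h
  refine ⟨f ∘ φ, g ∘ ψ, I₀, hφ.comp hf hf', hψ.comp hg hg', hI, ?_, hv⟩
  intro s hs t ht
  simpa [hf.dist_eq, hg.dist_eq] using hd s hs t ht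

instance setoid : Setoid MMSpace := ⟨Iso, Iso.refl, Iso.symm, Iso.trans⟩

end MMSpace

/-- The set `𝒳` of mm-isomorphism classes of mm-spaces. -/
def MMClass : Type 1 := Quotient MMSpace.setoid

namespace MMClass

/-- The Lipschitz order `≺` on `𝒳`. -/
def Prec : MMClass → MMClass → Prop :=
  Quotient.lift₂ MMSpace.Prec fun _ _ _ _ (hX : MMSpace.Iso _ _) (hY : MMSpace.Iso _ _) =>
    propext ⟨fun h => (hX.prec.trans h).trans hY.symm.prec,
      fun h => (hX.symm.prec.trans h).trans hY.prec⟩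

/-- The box distance on `𝒳`. -/
noncomputable def box : MMClass → MMClass → ℝ≥0∞ :=
  Quotient.lift₂ MMSpace.box fun _ _ _ _ (hX : MMSpace.Iso _ _) (hY : MMSpace.Iso _ _) =>
    le_antisymm
      (le_iInf₂ fun _ h => iInf₂_le _ (h.congr hX.symm hY.symm))
      (le_iInf₂ fun _ h => iInf₂_le _ (h.congr hX hY))

/-- The box distance `□(X, A) = inf_{Y ∈ A} □(X, Y)` from a point to a set. -/
noncomputable def boxToSet (X : MMClass) (A : Set MMClass) : ℝ≥0∞ :=
  ⨅ Y ∈ A, box X Y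

/-- The Hausdorff distance induced from the box distance. -/
noncomputable def boxHausdorff (A B : Set MMClass) : ℝ≥0∞ :=
  (⨆ X ∈ A, boxToSet X B) ⊔ (⨆ Y ∈ B, boxToSet Y A)

/-- `𝒳(N,R)`: the classes of `(B, ‖·‖_∞, μ)`, where `B` is the closed ball of radius `R` about `0`
in `(ℝ^N, ‖·‖_∞)` and `μ` is a Borel probability measure on `ℝ^N` with `supp μ ⊆ B`.
The norm of `Fin N → ℝ` is the sup norm. -/
def ballClasses (N : ℕ) (R : ℝ) : Set MMClass :=
  {X | ∃ (μ : Measure (Fin N → ℝ)) (_ : IsProbabilityMeasure μ),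
    μ.support ⊆ {x | ‖x‖ ≤ R} ∧ X = Quotient.mk _ (MMSpace.ofMeasure μ)}

end MMClass

/-- Pyramids; this type is the space `Π`. -/
@[ext]
structure Pyramid : Type 1 where
  carrier : Set MMClass
  lower : ∀ X ∈ carrier, ∀ Y, MMClass.Prec Y X → Y ∈ carrier
  directed : ∀ X ∈ carrier, ∀ X' ∈ carrier, ∃ Y ∈ carrier, MMClass.Prec X Y ∧ MMClass.Prec X' Y
  nonempty : carrier.Nonempty
  box_closed : ∀ X, (∀ ε : ℝ≥0∞, 0 < ε → ∃ Y ∈ carrier, MMClass.box X Y < ε) → X ∈ carrier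

namespace Pyramid

/-- Weak convergence of a sequence of pyramids. -/
def WeaklyConverges (P : ℕ → Pyramid) (Q : Pyramid) : Prop :=
  (∀ X ∈ Q.carrier, Tendsto (fun n => MMClass.boxToSet X (P n).carrier) atTop (𝓝 0)) ∧
  (∀ X ∉ Q.carrier, 0 < liminf (fun n => MMClass.boxToSet X (P n).carrier) atTop)

/-- `ρ_k`, for `k ≥ 1`. -/
noncomputable def rhoK (k : ℕ) (P Q : Pyramid) : ℝ≥0∞ :=
  (1 / (4 * (k : ℝ≥0∞))) * MMClass.boxHausdorff
    (P.carrier ∩ MMClass.ballClasses k k) (Q.carrier ∩ MMClass.ballClasses k k)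

/-- `ρ = ∑_{k ≥ 1} 2^{-k} ρ_k`; the term with index `k` in the code is the one of `k + 1`. -/
noncomputable def rho (P Q : Pyramid) : ℝ≥0∞ :=
  ∑' k : ℕ, ((2 : ℝ≥0∞) ^ (k + 1))⁻¹ * rhoK (k + 1) P Q

end Pyramid

/-! ### Lebesgue measure on `[0,1)` produces every law -/

namespace MMSpace

/-! A pyramid is determined by its slices `P ∩ ballClasses k k`. Every class `X` is box-approximated
by images under truncated distance coordinates, which lie in some `ballClasses k k` and are
dominated by `X` (`exists_mem_ballClasses_prec_edist_lt`). Conversely, if `X'` in `ballClasses N R`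
is dominated by `X` and `Y` is close to `X`, then McShane extension of the coordinates gives an
element of `ballClasses N R` dominated by `Y` and close to `X'`
(`exists_mem_ballClasses_prec_edist_le`). So distances to a pyramid and to its slices control each
other up to a factor `2` and small errors.

Box closeness is handled through couplings. Weak convergence of measures implies box convergence, so
each `ballClasses N R` is compact, being a continuous image of a compact set of measures.

Compactness of the space of pyramids is proved with ultrafilters. The classes whose distance to `P`
tends to `0` along `U` form a pyramid `Q`; directedness holds because the couplings of two fixed
laws form a compact set (`exists_dominating_of_ultrafilter`). Compactness of `ballClasses k k` turns
this pointwise limit into Hausdorff convergence of slices (`tendsto_hausdorffEDist_of_ultrafilter`),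
which is convergence in `rho`. The same lemma along all ultrafilters finer than `atTop` shows that
weak convergence implies `rho`-convergence; the converse is a direct estimate with approximants. -/

instance isProbabilityMeasure_lebesgueIco : IsProbabilityMeasure lebesgueIco := by
  refine ⟨?_⟩
  rw [lebesgueIco, comap_subtype_coe_apply measurableSet_Ico, image_univ, Subtype.range_coe,
    Real.volume_Ico, sub_zero, ENNReal.ofReal_one]

theorem exists_measurable_map_lebesgueIco_unitInterval :
    ∃ g : Set.Ico (0 : ℝ) 1 → unitInterval, Measurable g ∧ lebesgueIco.map g = volume := by
  have hg : Measurable fun x : Set.Ico (0 : ℝ) 1 =>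
    (⟨x, Ico_subset_Icc_self x.2⟩ : unitInterval) := measurable_subtype_coe.subtype_mk
  refine ⟨_, hg, ?_⟩
  ext s hs
  rw [Measure.map_apply hg hs, lebesgueIco,
    comap_subtype_coe_apply measurableSet_Ico, unitInterval.volume_apply]
  -- Passing from `[0,1]` to `[0,1)` loses only the endpoint `1`, a null set.
  have : (Subtype.val '' ((fun x : Set.Ico (0 : ℝ) 1 =>
      (⟨x, Ico_subset_Icc_self x.2⟩ : unitInterval)) ⁻¹' s)) = (Subtype.val '' s) \ {1} := by
    ext x
    simp only [mem_image, mem_preimage, Subtype.exists, mem_Ico, exists_and_right, exists_eq_right,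
      Set.mem_sdiff, mem_singleton_iff]
    constructor
    · rintro ⟨h, hx⟩
      exact ⟨⟨⟨h.1, h.2.le⟩, hx⟩, h.2.ne⟩
    · rintro ⟨⟨h, hx⟩, h1⟩
      exact ⟨⟨h.1, lt_of_le_of_ne h.2 h1⟩, hx⟩
  rw [this, measure_sdiff_null (by simp)]

theorem exists_measurable_map_lebesgueIco_eq {E : Type*} [MeasurableSpace E]
    [StandardBorelSpace E] (μ : Measure E) [IsProbabilityMeasure μ] :
    ∃ f : Set.Ico (0 : ℝ) 1 → E, Measurable f ∧ lebesgueIco.map f = μ := by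
  have : Nonempty E := nonempty_of_isProbabilityMeasure μ
  obtain ⟨f, hf, hfμ⟩ := μ.exists_measurable_map_eq
  obtain ⟨g, hg, hgv⟩ := exists_measurable_map_lebesgueIco_unitInterval
  exact ⟨f ∘ g, hf.comp hg, by rw [← Measure.map_map hf hg, hgv, hfμ]⟩

end MMSpace

/-! ### Gluing and completing couplings -/

namespace MeasureTheory

open ProbabilityTheory

/-- Two probability measures whose images under `f` and `g` agree have a coupling under which
`f` and `g` agree almost everywhere. -/
theorem exists_coupling_ae_eq {A B C : Type*} [MeasurableSpace A] [MeasurableSpace B]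
    [MeasurableSpace C] [StandardBorelSpace A] [StandardBorelSpace B] [StandardBorelSpace C]
    {α : Measure A} {β : Measure B} [IsProbabilityMeasure α] [IsProbabilityMeasure β]
    {f : A → C} {g : B → C} (hf : Measurable f) (hg : Measurable g) (h : α.map f = β.map g) :
    ∃ γ : Measure (A × B), IsProbabilityMeasure γ ∧ γ.fst = α ∧ γ.snd = β ∧
      ∀ᵐ p ∂γ, f p.1 = g p.2 := by
  have : Nonempty A := nonempty_of_isProbabilityMeasure α
  have : Nonempty B := nonempty_of_isProbabilityMeasure β
  have hfa : Measurable fun a => (f a, a) := hf.prodMk measurable_id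
  have hgb : Measurable fun b => (g b, b) := hg.prodMk measurable_id
  have : IsProbabilityMeasure (α.map fun a => (f a, a)) :=
    Measure.isProbabilityMeasure_map hfa.aemeasurable
  have : IsProbabilityMeasure (β.map fun b => (g b, b)) :=
    Measure.isProbabilityMeasure_map hgb.aemeasurable
  have : IsProbabilityMeasure (α.map f) := Measure.isProbabilityMeasure_map hf.aemeasurable
  set κ := (α.map fun a => (f a, a)).condKernel with hκ
  set η := (β.map fun b => (g b, b)).condKernel with hη
  have hκα : α.map f ⊗ₘ κ = α.map fun a => (f a, a) := by
    conv_rhs => rw [← Measure.disintegrate (α.map fun a => (f a, a)) κ]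
    rw [Measure.fst, Measure.map_map measurable_fst hfa]
    rfl
  have hηβ : α.map f ⊗ₘ η = β.map fun b => (g b, b) := by
    conv_rhs => rw [← Measure.disintegrate (β.map fun b => (g b, b)) η]
    rw [Measure.fst, Measure.map_map measurable_fst hgb, h]
    rfl
  -- Over each point of the common image law, draw from the two conditional laws independently.
  set m := α.map f ⊗ₘ (κ ×ₖ η) with hm
  have h1 : m.map (Prod.map id Prod.fst) = α.map fun a => (f a, a) := by
    rw [hm, ← Measure.compProd_map measurable_fst, ← Kernel.fst_eq, Kernel.fst_prod, hκα]
  have h2 : m.map (Prod.map id Prod.snd) = β.map fun b => (g b, b) := by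
    rw [hm, ← Measure.compProd_map measurable_snd, ← Kernel.snd_eq, Kernel.snd_prod, hηβ]
  have m1 : Measurable (Prod.map id Prod.fst : C × A × B → C × A) :=
    measurable_id.prodMap measurable_fst
  have m2 : Measurable (Prod.map id Prod.snd : C × A × B → C × B) :=
    measurable_id.prodMap measurable_snd
  refine ⟨m.snd, inferInstance, ?_, ?_, ?_⟩
  · have := congrArg Measure.snd h1
    rw [Measure.snd, Measure.map_map measurable_snd m1, Measure.snd,
      Measure.map_map measurable_snd hfa] at this
    rw [Measure.fst, Measure.snd, Measure.map_map measurable_fst measurable_snd]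
    exact this.trans Measure.map_id
  · have := congrArg Measure.snd h2
    rw [Measure.snd, Measure.map_map measurable_snd m2, Measure.snd,
      Measure.map_map measurable_snd hgb] at this
    rw [Measure.snd, Measure.snd, Measure.map_map measurable_snd measurable_snd]
    exact this.trans Measure.map_id
  · have e1 : ∀ᵐ p ∂m, p.1 = f p.2.1 := by
      have : ∀ᵐ q ∂(m.map (Prod.map id Prod.fst)), q.1 = f q.2 := by
        have hs : MeasurableSet {q : C × A | q.1 = f q.2} :=
          measurableSet_eq_fun measurable_fst (hf.comp measurable_snd)
        rw [h1, ae_map_iff hfa.aemeasurable hs]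
        simp
      exact ae_of_ae_map m1.aemeasurable this
    have e2 : ∀ᵐ p ∂m, p.1 = g p.2.2 := by
      have : ∀ᵐ q ∂(m.map (Prod.map id Prod.snd)), q.1 = g q.2 := by
        have hs : MeasurableSet {q : C × B | q.1 = g q.2} :=
          measurableSet_eq_fun measurable_fst (hg.comp measurable_snd)
        rw [h2, ae_map_iff hgb.aemeasurable hs]
        simp
      exact ae_of_ae_map m2.aemeasurable this
    have hs : MeasurableSet {p : A × B | f p.1 = g p.2} :=
      measurableSet_eq_fun (hf.comp measurable_fst) (hg.comp measurable_snd)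
    rw [Measure.snd, ae_map_iff measurable_snd.aemeasurable hs]
    filter_upwards [e1, e2] with p h1 h2
    rw [← h1, h2]

theorem Measure.inv_smul_smul_of_measure_univ_eq {T : Type*} [MeasurableSpace T] {m : Measure T}
    [IsFiniteMeasure m] {r : ℝ≥0∞} (hm : m univ = r) : r⁻¹ • r • m = m := by
  by_cases h0 : r = 0
  · rw [h0, Measure.measure_univ_eq_zero] at hm
    simp [hm]
  · rw [smul_smul, ENNReal.inv_mul_cancel h0 (hm ▸ measure_ne_top m univ), one_smul]

/-- A measure whose marginals are dominated by two probability measures is dominated by a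
coupling of them. -/
theorem exists_coupling_ge {A B : Type*} [MeasurableSpace A] [MeasurableSpace B]
    {μ : Measure A} {ν : Measure B} [IsProbabilityMeasure μ] [IsProbabilityMeasure ν]
    {π₀ : Measure (A × B)} (h1 : π₀.fst ≤ μ) (h2 : π₀.snd ≤ ν) :
    ∃ π : Measure (A × B), IsProbabilityMeasure π ∧ π.fst = μ ∧ π.snd = ν ∧ π₀ ≤ π := by
  have : IsFiniteMeasure π₀ := ⟨by
    rw [← Measure.fst_univ]; exact (h1 univ).trans_lt (measure_lt_top _ _)⟩
  set r := 1 - π₀ univ with hr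
  have hr1 : (μ - π₀.fst) univ = r := by
    rw [Measure.sub_apply .univ h1, measure_univ, Measure.fst_univ]
  have hr2 : (ν - π₀.snd) univ = r := by
    rw [Measure.sub_apply .univ h2, measure_univ, Measure.snd_univ]
  -- Both marginals lack the same mass `r`; the normalised product of the deficits supplies it.
  have hfst : (π₀ + r⁻¹ • (μ - π₀.fst).prod (ν - π₀.snd)).fst = μ := by
    rw [Measure.fst_add, show (r⁻¹ • (μ - π₀.fst).prod (ν - π₀.snd)).fst = Measure.map Prod.fst _ from rfl,
      Measure.map_smul,
      Measure.map_fst_prod, hr2, Measure.inv_smul_smul_of_measure_univ_eq hr1, add_comm]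
    exact Measure.sub_add_cancel_of_le h1
  have hsnd : (π₀ + r⁻¹ • (μ - π₀.fst).prod (ν - π₀.snd)).snd = ν := by
    rw [Measure.snd_add, show (r⁻¹ • (μ - π₀.fst).prod (ν - π₀.snd)).snd = Measure.map Prod.snd _ from rfl,
      Measure.map_smul,
      Measure.map_snd_prod, hr1, Measure.inv_smul_smul_of_measure_univ_eq hr2, add_comm]
    exact Measure.sub_add_cancel_of_le h2
  refine ⟨_, ⟨?_⟩, hfst, hsnd, Measure.le_add_right le_rfl⟩
  rw [← Measure.fst_univ, hfst, measure_univ]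

/-- Two probability measures have a coupling which matches as much mass as possible within each
set of a finite disjoint family. -/
theorem exists_coupling_biUnion_prod {E ι : Type*} [MeasurableSpace E] {μ ν : Measure E}
    [IsProbabilityMeasure μ] [IsProbabilityMeasure ν] (T : Finset ι) {A : ι → Set E}
    (hA : ∀ i, MeasurableSet (A i)) (hd : (T : Set ι).Pairwise (Function.onFun Disjoint A)) :
    ∃ π : Measure (E × E), IsProbabilityMeasure π ∧ π.fst = μ ∧ π.snd = ν ∧
      ∑ i ∈ T, min (μ (A i)) (ν (A i)) ≤ π (⋃ i ∈ T, A i ×ˢ A i) := by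
  set M : ι → ℝ≥0∞ := fun i => max (μ (A i)) (ν (A i)) with hM
  have hMt : ∀ i, M i ≠ ∞ := fun i => by simp [hM]
  -- Dividing by the larger mass keeps both marginals below `μ` and `ν` on `A i`, and the total mass
  -- becomes the smaller of the two.
  set p : ι → Measure (E × E) := fun i =>
    (M i)⁻¹ • (μ.restrict (A i)).prod (ν.restrict (A i)) with hp
  have hsum : ∀ (m : Measure E), ∑ i ∈ T, m.restrict (A i) ≤ m := by
    intro m
    refine le_trans (le_of_eq ?_) (Measure.restrict_le_self (s := ⋃ i ∈ T, A i))
    rw [Measure.restrict_biUnion_finset hd hA, Measure.sum_fintype, Finset.sum_coe_sort T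
      (fun i => m.restrict (A i))]
  have hle : ∀ (m : Measure E) (c : ι → ℝ≥0∞), (∀ i, c i ≤ M i) →
      ∑ i ∈ T, (M i)⁻¹ • c i • m.restrict (A i) ≤ m := by
    intro m c hc
    refine le_trans (Finset.sum_le_sum fun i _ => ?_) (hsum m)
    rw [smul_smul]
    calc ((M i)⁻¹ * c i) • m.restrict (A i) ≤ (1 : ℝ≥0∞) • m.restrict (A i) := by
          gcongr
          rw [mul_comm, ← div_eq_mul_inv]
          exact ENNReal.div_le_of_le_mul (by simpa using hc i)
      _ = _ := one_smul _ _
  obtain ⟨π, hπ, h1, h2, hle⟩ := exists_coupling_ge (μ := μ) (ν := ν) (π₀ := ∑ i ∈ T, p i) (by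
      rw [Measure.fst, Measure.map_finset_sum measurable_fst.aemeasurable]
      simp only [hp, Measure.map_smul, Measure.map_fst_prod, Measure.restrict_apply_univ]
      exact hle μ _ fun i => le_max_right _ _) (by
      rw [Measure.snd, Measure.map_finset_sum measurable_snd.aemeasurable]
      simp only [hp, Measure.map_smul, Measure.map_snd_prod, Measure.restrict_apply_univ]
      exact hle ν _ fun i => le_max_left _ _)
  refine ⟨π, hπ, h1, h2, le_trans ?_ (hle _)⟩
  rw [Measure.finsetSum_apply]
  refine Finset.sum_le_sum fun i hi => ?_
  have : p i (A i ×ˢ A i) ≤ p i (⋃ i ∈ T, A i ×ˢ A i) :=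
    measure_mono (subset_biUnion_of_mem (u := fun i => A i ×ˢ A i) hi)
  refine le_trans ?_ this
  simp only [hp, Measure.smul_apply, Measure.prod_prod, Measure.restrict_apply_self, smul_eq_mul]
  by_cases h0 : M i = 0
  · have : μ (A i) = 0 := le_antisymm ((le_max_left _ _).trans h0.le) bot_le
    simp [this]
  · rw [← max_mul_min (μ (A i)), ← mul_assoc, ENNReal.inv_mul_cancel h0 (hMt i), one_mul]

end MeasureTheory

/-! ### The box distance through couplings -/

namespace MeasureTheory

theorem le_measureReal_inter {Ω : Type*} [MeasurableSpace Ω] {P : Measure Ω}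
    [IsProbabilityMeasure P] {S T : Set Ω} {a b : ℝ} (hT : MeasurableSet T)
    (hS' : 1 - a ≤ P.real S) (hT' : 1 - b ≤ P.real T) : 1 - (a + b) ≤ P.real (S ∩ T) := by
  have h1 := measureReal_inter_add_sdiff (μ := P) (s := S) hT
  have h2 : P.real (S \ T) ≤ P.real Tᶜ := measureReal_mono fun x hx => hx.2
  have h3 := probReal_compl_eq_one_sub (μ := P) hT
  linarith

end MeasureTheory

namespace MMSpace

instance (X : MMSpace) : SecondCountableTopology X :=
  UniformSpace.secondCountable_of_separable X

instance (X : MMSpace) : Nonempty X := nonempty_of_isProbabilityMeasure X.μ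

section Realization

variable {Ω : Type*} [MeasurableSpace Ω] {P : Measure Ω}

/-- A random variable whose law is the image of `μ_X` under an isometric embedding of `X` comes
from a random variable with values in `X`. -/
theorem exists_lift {X : MMSpace} {E : Type*} [MetricSpace E] [SecondCountableTopology E]
    [MeasurableSpace E] [BorelSpace E] {i : X → E} (hi : Isometry i) {f : Ω → E}
    (hf : Measurable f) (h : P.map f = X.μ.map i) :
    ∃ f' : Ω → X, Measurable f' ∧ P.map f' = X.μ ∧ ∀ᵐ ω ∂P, i (f' ω) = f ω := by
  have hc := hi.isClosedEmbedding
  have he := hc.measurableEmbedding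
  have hr : MeasurableSet (range i) := hc.isClosed_range.measurableSet
  have hae : ∀ᵐ ω ∂P, i (he.invFun (f ω)) = f ω := by
    have : ∀ᵐ y ∂(P.map f), y ∈ range i := by
      rw [h]
      exact (ae_map_iff (p := (· ∈ range i)) he.measurable.aemeasurable hr).2 (by simp)
    filter_upwards [ae_of_ae_map hf.aemeasurable this] with ω hω
    obtain ⟨x, hx⟩ := hω
    rw [← hx, he.leftInverse_invFun x]
  refine ⟨he.invFun ∘ f, he.measurable_invFun.comp hf, ?_, hae⟩
  rw [← Measure.map_map he.measurable_invFun hf, h,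
    Measure.map_map he.measurable_invFun he.measurable, he.leftInverse_invFun.id, Measure.map_id]

variable [IsProbabilityMeasure P]

/-- Only the joint law of `f` and `g` matters, and it is an image of Lebesgue measure on `[0,1)`.
Since the distortion bound is a closed condition, the closure of the image of `S` serves as a
measurable good set, so `S` itself may be arbitrary. -/
theorem box_le_of_maps {X Y : MMSpace} {f : Ω → X} {g : Ω → Y} (hf : Measurable f)
    (hg : Measurable g) (hfX : P.map f = X.μ) (hgY : P.map g = Y.μ) {S : Set Ω} {ε : ℝ≥0}
    (hd : ∀ s ∈ S, ∀ t ∈ S, |dist (f s) (f t) - dist (g s) (g t)| ≤ ε)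
    (hm : 1 - (ε : ℝ) ≤ P.real S) : box X Y ≤ ε := by
  have hfg : Measurable fun ω => (f ω, g ω) := hf.prodMk hg
  have : IsProbabilityMeasure (P.map fun ω => (f ω, g ω)) :=
    Measure.isProbabilityMeasure_map hfg.aemeasurable
  obtain ⟨h, hh, hhP⟩ := exists_measurable_map_lebesgueIco_eq (P.map fun ω => (f ω, g ω))
  set A := closure ((fun ω => (f ω, g ω)) '' S) with hA
  have hAm : MeasurableSet A := isClosed_closure.measurableSet
  have hdA : ∀ p ∈ A, ∀ q ∈ A, |dist p.1 q.1 - dist p.2 q.2| ≤ ε := by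
    have hcl : IsClosed {r : (X × Y) × (X × Y) |
        |dist r.1.1 r.2.1 - dist r.1.2 r.2.2| ≤ ε} :=
      isClosed_le (by fun_prop) continuous_const
    intro p hp q hq
    have hpq : (p, q) ∈ closure
        (((fun ω => (f ω, g ω)) '' S) ×ˢ ((fun ω => (f ω, g ω)) '' S)) := by
      rw [closure_prod_eq]; exact ⟨hp, hq⟩
    refine closure_minimal ?_ hcl hpq
    rintro ⟨_, _⟩ ⟨⟨s, hs, rfl⟩, ⟨t, ht, rfl⟩⟩
    exact hd s hs t ht
  refine iInf₂_le ε ⟨fun t => (h t).1, fun t => (h t).2, h ⁻¹' A, ⟨hh.fst, ?_⟩, ⟨hh.snd, ?_⟩,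
    hh hAm, fun s hs t ht => hdA _ hs _ ht, ?_⟩
  · rw [← hfX]
    have := congrArg (Measure.map Prod.fst) hhP
    rwa [Measure.map_map measurable_fst hh, Measure.map_map measurable_fst hfg] at this
  · rw [← hgY]
    have := congrArg (Measure.map Prod.snd) hhP
    rwa [Measure.map_map measurable_snd hh, Measure.map_map measurable_snd hfg] at this
  · refine hm.trans ?_
    rw [← map_measureReal_apply hh hAm, hhP, map_measureReal_apply hfg hAm]
    exact measureReal_mono fun s hs => subset_closure ⟨s, hs, rfl⟩

/-- Correcting `f` and `g` on a null set makes them take values in `X` and `Y`. This allows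
`ofMeasure μ` to be estimated in the ambient space instead of the support. -/
theorem box_le_of_isometries {X Y : MMSpace} {E F : Type*} [MetricSpace E]
    [SecondCountableTopology E] [MeasurableSpace E] [BorelSpace E] [MetricSpace F]
    [SecondCountableTopology F] [MeasurableSpace F] [BorelSpace F] {i : X → E} (hi : Isometry i)
    {j : Y → F} (hj : Isometry j) {f : Ω → E} {g : Ω → F} (hf : Measurable f)
    (hg : Measurable g) (hfX : P.map f = X.μ.map i) (hgY : P.map g = Y.μ.map j) {S : Set Ω}
    {ε : ℝ≥0} (hd : ∀ s ∈ S, ∀ t ∈ S, |dist (f s) (f t) - dist (g s) (g t)| ≤ ε)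
    (hm : 1 - (ε : ℝ) ≤ P.real S) : box X Y ≤ ε := by
  obtain ⟨f', hf', hf'X, hf'e⟩ := exists_lift hi hf hfX
  obtain ⟨g', hg', hg'Y, hg'e⟩ := exists_lift hj hg hgY
  refine box_le_of_maps hf' hg' hf'X hg'Y
    (S := S ∩ {ω | i (f' ω) = f ω ∧ j (g' ω) = g ω}) ?_ ?_
  · rintro s ⟨hs, hs1, hs2⟩ t ⟨ht, ht1, ht2⟩
    rw [← hi.dist_eq, ← hj.dist_eq, hs1, hs2, ht1, ht2]
    exact hd s hs t ht
  · refine hm.trans (le_of_eq (measureReal_congr ?_))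
    filter_upwards [hf'e, hg'e] with ω h1 h2
    refine propext ⟨fun h => ⟨h, h1, h2⟩, fun h => h.1⟩

end Realization

theorem map_val_ofMeasure {E : Type} [MetricSpace E] [CompleteSpace E]
    [TopologicalSpace.SeparableSpace E] [MeasurableSpace E] [BorelSpace E]
    (μ : Measure E) [IsProbabilityMeasure μ] :
    (ofMeasure μ).μ.map (Subtype.val : μ.support → E) = μ := by
  have : SecondCountableTopology E := UniformSpace.secondCountable_of_separable E
  change (μ.comap Subtype.val).map _ = μ
  rw [map_comap_subtype_coe μ.isClosed_support.measurableSet]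
  exact Measure.restrict_eq_self_of_ae_mem μ.support_mem_ae

theorem isometry_val_ofMeasure {E : Type} [MetricSpace E] [CompleteSpace E]
    [TopologicalSpace.SeparableSpace E] [MeasurableSpace E] [BorelSpace E]
    (μ : Measure E) [IsProbabilityMeasure μ] :
    Isometry (fun x : ofMeasure μ => (Subtype.val : μ.support → E) x) :=
  isometry_subtype_coe

theorem BoxAdmissible.exists_coupling {X Y : MMSpace} {ε : ℝ≥0} (h : BoxAdmissible X Y ε) :
    ∃ (π : Measure (X × Y)) (S : Set (X × Y)), IsProbabilityMeasure π ∧ π.fst = X.μ ∧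
      π.snd = Y.μ ∧ MeasurableSet S ∧
      (∀ p ∈ S, ∀ q ∈ S, |dist p.1 q.1 - dist p.2 q.2| ≤ (ε : ℝ)) ∧
      1 - (ε : ℝ) ≤ π.real S := by
  obtain ⟨φ, ψ, I₀, hφ, hψ, hI, hd, hm⟩ := h
  have hφψ : Measurable fun t => (φ t, ψ t) := hφ.1.prodMk hψ.1
  set A := closure ((fun t => (φ t, ψ t)) '' I₀) with hA
  have hAm : MeasurableSet A := isClosed_closure.measurableSet
  refine ⟨lebesgueIco.map fun t => (φ t, ψ t), A,
    Measure.isProbabilityMeasure_map hφψ.aemeasurable, ?_, ?_, hAm, ?_, ?_⟩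
  · rw [Measure.fst, Measure.map_map measurable_fst hφψ, ← hφ.2]; rfl
  · rw [Measure.snd, Measure.map_map measurable_snd hφψ, ← hψ.2]; rfl
  · have hcl : IsClosed {r : (X × Y) × (X × Y) |
        |dist r.1.1 r.2.1 - dist r.1.2 r.2.2| ≤ ε} :=
      isClosed_le (by fun_prop) continuous_const
    intro p hp q hq
    have hpq : (p, q) ∈ closure
        (((fun t => (φ t, ψ t)) '' I₀) ×ˢ ((fun t => (φ t, ψ t)) '' I₀)) := by
      rw [closure_prod_eq]; exact ⟨hp, hq⟩
    refine closure_minimal ?_ hcl hpq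
    rintro ⟨_, _⟩ ⟨⟨s, hs, rfl⟩, ⟨t, ht, rfl⟩⟩
    exact hd s hs t ht
  · refine hm.trans ?_
    rw [map_measureReal_apply hφψ hAm]
    exact measureReal_mono fun s hs => subset_closure ⟨s, hs, rfl⟩

theorem exists_coupling_of_box_lt {X Y : MMSpace} {δ : ℝ≥0∞} (h : box X Y < δ) :
    ∃ (ε : ℝ≥0) (π : Measure (X × Y)) (S : Set (X × Y)), (ε : ℝ≥0∞) < δ ∧
      IsProbabilityMeasure π ∧ π.fst = X.μ ∧ π.snd = Y.μ ∧ MeasurableSet S ∧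
      (∀ p ∈ S, ∀ q ∈ S, |dist p.1 q.1 - dist p.2 q.2| ≤ (ε : ℝ)) ∧
      1 - (ε : ℝ) ≤ π.real S := by
  simp only [box, iInf_lt_iff] at h
  obtain ⟨ε, hε, hlt⟩ := h
  obtain ⟨π, S, h⟩ := hε.exists_coupling
  exact ⟨ε, π, S, hlt, h⟩

theorem box_self (X : MMSpace) : box X X = 0 := by
  refine le_antisymm ?_ bot_le
  exact_mod_cast box_le_of_maps (P := X.μ) (f := id) (g := id) (S := univ) (ε := 0)
    measurable_id measurable_id Measure.map_id Measure.map_id (by simp) (by simp)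

theorem BoxAdmissible.symm {X Y : MMSpace} {ε : ℝ≥0} (h : BoxAdmissible X Y ε) :
    BoxAdmissible Y X ε := by
  obtain ⟨φ, ψ, I₀, hφ, hψ, hI, hd, hm⟩ := h
  exact ⟨ψ, φ, I₀, hψ, hφ, hI, fun s hs t ht => by rw [abs_sub_comm]; exact hd s hs t ht, hm⟩

theorem box_comm (X Y : MMSpace) : box X Y = box Y X :=
  le_antisymm (le_iInf₂ fun _ h => iInf₂_le _ h.symm) (le_iInf₂ fun _ h => iInf₂_le _ h.symm)

theorem box_le_one (X Y : MMSpace) : box X Y ≤ 1 := by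
  exact_mod_cast box_le_of_maps (P := X.μ.prod Y.μ) (f := Prod.fst) (g := Prod.snd) (S := ∅)
    (ε := 1) measurable_fst measurable_snd (by simp) (by simp) (by simp) (by simp)

/-- Glue the two couplings along `Y`: distortions add, and so do the masses of the exceptional sets.
-/
theorem box_triangle (X Y Z : MMSpace) : box X Z ≤ box X Y + box Y Z := by
  conv_rhs => rw [box, box]
  simp_rw [ENNReal.iInf_add, ENNReal.add_iInf]
  refine le_iInf₂ fun ε₁ h₁ => le_iInf₂ fun ε₂ h₂ => ?_
  obtain ⟨π₁, S₁, _, hX, hY, hS₁, hd₁, hm₁⟩ := h₁.exists_coupling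
  obtain ⟨π₂, S₂, _, hY', hZ, hS₂, hd₂, hm₂⟩ := h₂.exists_coupling
  obtain ⟨γ, _, hγ₁, hγ₂, hγ⟩ := exists_coupling_ae_eq (f := Prod.snd) (g := Prod.fst)
    measurable_snd measurable_fst (hY.trans hY'.symm)
  rw [← ENNReal.coe_add]
  refine box_le_of_maps (P := γ) (f := fun p => p.1.1) (g := fun p => p.2.2)
    (S := (Prod.fst ⁻¹' S₁ ∩ Prod.snd ⁻¹' S₂) ∩ {p | p.1.2 = p.2.1}) (by fun_prop) (by fun_prop)
    ?_ ?_ ?_ ?_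
  · rw [← hX, ← hγ₁, Measure.fst, Measure.fst, Measure.map_map measurable_fst measurable_fst]
    rfl
  · rw [← hZ, ← hγ₂, Measure.snd, Measure.snd, Measure.map_map measurable_snd measurable_snd]
    rfl
  · rintro s ⟨⟨hs1, hs2⟩, hs⟩ t ⟨⟨ht1, ht2⟩, ht⟩
    have e1 := hd₁ _ hs1 _ ht1
    have e2 := hd₂ _ hs2 _ ht2
    simp only [mem_ofPred_eq] at hs ht
    rw [hs, ht] at e1
    push_cast
    rw [abs_le] at *
    constructor <;> linarith
  · have h0 : γ.real ((Prod.fst ⁻¹' S₁ ∩ Prod.snd ⁻¹' S₂) ∩ {p | p.1.2 = p.2.1}) =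
        γ.real (Prod.fst ⁻¹' S₁ ∩ Prod.snd ⁻¹' S₂) := by
      refine measureReal_congr ?_
      filter_upwards [hγ] with p hp
      exact propext ⟨fun h => h.1, fun h => ⟨h, hp⟩⟩
    rw [h0]
    push_cast
    refine le_measureReal_inter (measurable_snd hS₂) ?_ ?_
    · rw [← map_measureReal_apply measurable_fst hS₁]
      exact hm₁.trans_eq (by rw [← hγ₁]; rfl)
    · rw [← map_measureReal_apply measurable_snd hS₂]
      exact hm₂.trans_eq (by rw [← hγ₂]; rfl)

end MMSpace

/-! ### The pseudometric on classes -/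

namespace MMClass

/-- A pseudometric suffices: the closedness of pyramids replaces the separation of classes by the
box distance. -/
noncomputable instance : PseudoEMetricSpace MMClass where
  edist := box
  edist_self := by rintro ⟨X⟩; exact X.box_self
  edist_comm := by rintro ⟨X⟩ ⟨Y⟩; exact X.box_comm Y
  edist_triangle := by rintro ⟨X⟩ ⟨Y⟩ ⟨Z⟩; exact X.box_triangle Y Z

/-- The mm-isomorphism class of an mm-space. -/
def mk (X : MMSpace) : MMClass := Quotient.mk _ X

theorem mk_surjective : Function.Surjective mk := Quotient.mk_surjective

theorem Prec.trans {X Y Z : MMClass} (h : X.Prec Y) (h' : Y.Prec Z) : X.Prec Z := by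
  obtain ⟨X, rfl⟩ := mk_surjective X
  obtain ⟨Y, rfl⟩ := mk_surjective Y
  obtain ⟨Z, rfl⟩ := mk_surjective Z
  exact MMSpace.Prec.trans h h'

theorem edist_le_one (X Y : MMClass) : edist X Y ≤ 1 := by
  obtain ⟨X, rfl⟩ := mk_surjective X
  obtain ⟨Y, rfl⟩ := mk_surjective Y
  exact MMSpace.box_le_one _ _

theorem boxHausdorff_eq_hausdorffEDist (A B : Set MMClass) :
    boxHausdorff A B = Metric.hausdorffEDist A B := by
  rw [Metric.hausdorffEDist]; rfl

end MMClass

namespace Pyramid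

theorem isClosed_carrier (P : Pyramid) : IsClosed P.carrier := by
  refine isClosed_of_closure_subset fun X hX => P.box_closed X fun ε hε => ?_
  exact EMetric.mem_closure_iff.1 hX ε hε

end Pyramid

/-! ### Small cells with null boundaries; compactness of coupling sets -/

namespace MeasureTheory

/-- A countable cover of a separable metric space by small disjoint sets whose boundaries are
null. -/
theorem exists_disjoint_null_frontier_cover {E : Type*} [MetricSpace E]
    [TopologicalSpace.SeparableSpace E] [MeasurableSpace E] [BorelSpace E] (μ : Measure E)
    [IsProbabilityMeasure μ] {r : ℝ} (hr : 0 < r) :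
    ∃ A : ℕ → Set E, (∀ n, MeasurableSet (A n)) ∧ Pairwise (Function.onFun Disjoint A) ∧
      (⋃ n, A n) = univ ∧ (∀ n, μ (frontier (A n)) = 0) ∧
      ∀ n, ∀ x ∈ A n, ∀ y ∈ A n, dist x y ≤ r := by
  have : Nonempty E := nonempty_of_isProbabilityMeasure μ
  -- Radii above `r / 4` make the balls cover, radii below `r / 2` bound their diameter by `r`, and
  -- the choice in between avoids charged boundaries.
  choose q hq hqμ using fun n : ℕ => exists_null_frontier_thickening μ
    {TopologicalSpace.denseSeq E n} (a := r / 4) (b := r / 2) (by linarith)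
  set B : ℕ → Set E := fun n => Metric.thickening (q n) {TopologicalSpace.denseSeq E n} with hB
  refine ⟨disjointed B, fun n => MeasurableSet.disjointed
    (fun n => Metric.isOpen_thickening.measurableSet) n, disjoint_disjointed B, ?_, fun n => ?_,
    fun n x hx y hy => ?_⟩
  · rw [iUnion_disjointed]
    refine eq_univ_of_forall fun x => ?_
    obtain ⟨n, hn⟩ := (TopologicalSpace.denseRange_denseSeq E).exists_dist_lt x
      (show 0 < r / 4 by linarith)
    exact mem_iUnion.2 ⟨n, by
      simp only [hB, Metric.thickening_singleton, Metric.mem_ball]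
      exact hn.trans (hq n).1⟩
  · refine disjointedRec (p := fun s => μ (frontier s) = 0) (fun t i ht => ?_) (hqμ n)
    rw [Set.sdiff_eq]
    exact null_frontier_inter ht (by rw [frontier_compl]; exact hqμ i)
  · have h1 := disjointed_subset B n hx
    have h2 := disjointed_subset B n hy
    simp only [hB, Metric.thickening_singleton, Metric.mem_ball] at h1 h2
    have := dist_triangle_right x y (TopologicalSpace.denseSeq E n)
    linarith [(hq n).2]

/-- The set of couplings of two probability measures on Polish spaces is compact. -/
theorem isCompact_setOf_couplings {A B : Type*} [MetricSpace A] [CompleteSpace A]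
    [SecondCountableTopology A] [MeasurableSpace A] [BorelSpace A] [MetricSpace B]
    [CompleteSpace B] [SecondCountableTopology B] [MeasurableSpace B] [BorelSpace B]
    (μ : ProbabilityMeasure A) (ν : ProbabilityMeasure B) :
    IsCompact {π : ProbabilityMeasure (A × B) |
      (π : Measure (A × B)).fst = μ ∧ (π : Measure (A × B)).snd = ν} := by
  set S := {π : ProbabilityMeasure (A × B) |
      (π : Measure (A × B)).fst = μ ∧ (π : Measure (A × B)).snd = ν} with hS
  have hcl : IsClosed S := by
    have h1 : S = {π | π.map measurable_fst.aemeasurable = μ} ∩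
        {π | π.map measurable_snd.aemeasurable = ν} := by
      ext π
      exact ⟨fun h => ⟨Subtype.ext h.1, Subtype.ext h.2⟩,
        fun h => ⟨congrArg Subtype.val h.1, congrArg Subtype.val h.2⟩⟩
    rw [h1]
    exact (isClosed_eq (ProbabilityMeasure.continuous_map continuous_fst) continuous_const).inter
      (isClosed_eq (ProbabilityMeasure.continuous_map continuous_snd) continuous_const)
  rw [← hcl.closure_eq]
  refine isCompact_closure_of_isTightMeasureSet ?_
  rw [isTightMeasureSet_iff_exists_isCompact_measure_compl_le]
  intro ε hε
  obtain ⟨K, hK, hKμ⟩ := isTightMeasureSet_iff_exists_isCompact_measure_compl_le.1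
    (isTightMeasureSet_singleton (μ := (μ : Measure A))) (ε / 2) (ENNReal.half_pos hε.ne')
  obtain ⟨L, hL, hLν⟩ := isTightMeasureSet_iff_exists_isCompact_measure_compl_le.1
    (isTightMeasureSet_singleton (μ := (ν : Measure B))) (ε / 2) (ENNReal.half_pos hε.ne')
  refine ⟨K ×ˢ L, hK.prod hL, ?_⟩
  rintro _ ⟨π, ⟨h1, h2⟩, rfl⟩
  -- Tightness depends on the marginals only; Prokhorov's theorem then gives compactness.
  have hsub : (K ×ˢ L)ᶜ ⊆ Prod.fst ⁻¹' Kᶜ ∪ Prod.snd ⁻¹' Lᶜ := by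
    rintro ⟨a, b⟩ h
    simp only [mem_compl_iff, mem_prod, not_and_or] at h
    exact h
  calc (π : Measure (A × B)) (K ×ˢ L)ᶜ
      ≤ (π : Measure (A × B)) (Prod.fst ⁻¹' Kᶜ) + (π : Measure (A × B)) (Prod.snd ⁻¹' Lᶜ) :=
        (measure_mono hsub).trans (measure_union_le _ _)
    _ = (μ : Measure A) Kᶜ + (ν : Measure B) Lᶜ := by
        rw [← Measure.fst_apply hK.measurableSet.compl, ← Measure.snd_apply hL.measurableSet.compl,
          h1, h2]
    _ ≤ ε / 2 + ε / 2 := add_le_add (hKμ _ rfl) (hLν _ rfl)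
    _ = ε := ENNReal.add_halves ε

end MeasureTheory

/-! ### Weak convergence, box convergence and compactness of `ballClasses` -/

namespace MMClass

open MMSpace

section OfMeasure

variable {E : Type} [MetricSpace E] [CompleteSpace E] [TopologicalSpace.SeparableSpace E]
  [MeasurableSpace E] [BorelSpace E]

/-- Weak convergence of probability measures implies box convergence. -/
theorem continuous_mk_ofMeasure :
    Continuous fun μ : ProbabilityMeasure E => mk (ofMeasure (μ : Measure E)) := by
  have : SecondCountableTopology E := UniformSpace.secondCountable_of_separable E
  refine continuous_iff_continuousAt.2 fun μ => ?_
  rw [ContinuousAt, tendsto_iff_edist_tendsto_0, ENNReal.tendsto_nhds_zero]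
  intro δ hδ
  obtain ⟨ε, hε, hεδ⟩ := ENNReal.lt_iff_exists_nnreal_btwn.1 hδ
  have hε : 0 < ε := by exact_mod_cast hε
  obtain ⟨A, hAm, hAd, hAu, hAf, hAr⟩ := exists_disjoint_null_frontier_cover (μ : Measure E)
    (r := ε / 2) (by positivity)
  have htsum : ∑' n, (μ : Measure E) (A n) = 1 := by
    rw [← measure_iUnion hAd hAm, hAu, measure_univ]
  have hlt : (1 : ℝ≥0∞) - ε < 1 :=
    ENNReal.sub_lt_self ENNReal.one_ne_top one_ne_zero (by exact_mod_cast hε.ne')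
  obtain ⟨m, hm⟩ := ((ENNReal.tendsto_nat_tsum fun n => (μ : Measure E) (A n)).eventually
    (lt_mem_nhds (htsum.symm ▸ hlt))).exists
  -- Finitely many cells carry mass above `1 - ε`, and their masses converge by the portmanteau
  -- theorem. A coupling matching mass cell by cell moves points by at most `ε / 2`, hence has
  -- distortion at most `ε`.
  have hlim : Tendsto (fun ν : ProbabilityMeasure E =>
      ∑ i ∈ Finset.range m, min ((ν : Measure E) (A i)) ((μ : Measure E) (A i))) (𝓝 μ)
      (𝓝 (∑ i ∈ Finset.range m, (μ : Measure E) (A i))) := by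
    refine tendsto_finsetSum _ fun i _ => ?_
    have := (ProbabilityMeasure.tendsto_measure_of_null_frontier_of_tendsto' tendsto_id
      (hAf i)).min (tendsto_const_nhds (x := (μ : Measure E) (A i)))
    simpa using this
  filter_upwards [hlim.eventually (lt_mem_nhds hm)] with ν hν
  obtain ⟨π, _, h1, h2, hπ⟩ := exists_coupling_biUnion_prod (μ := (ν : Measure E))
    (ν := (μ : Measure E)) (Finset.range m) hAm (hAd.set_pairwise _)
  refine le_trans ?_ hεδ.le
  refine box_le_of_isometries (P := π) (isometry_val_ofMeasure (ν : Measure E))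
    (isometry_val_ofMeasure (μ : Measure E)) measurable_fst measurable_snd
    (h1.trans (map_val_ofMeasure _).symm) (h2.trans (map_val_ofMeasure _).symm)
    (S := ⋃ i ∈ Finset.range m, A i ×ˢ A i) ?_ ?_
  · intro s hs t ht
    simp only [mem_iUnion] at hs ht
    obtain ⟨i, -, hi1, hi2⟩ := hs
    obtain ⟨j, -, hj1, hj2⟩ := ht
    have e1 := hAr i _ hi1 _ hi2
    have e2 := hAr j _ hj1 _ hj2
    have := dist_triangle4 s.1 s.2 t.2 t.1
    have := dist_triangle4 s.2 s.1 t.1 t.2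
    rw [dist_comm s.2 s.1] at this
    rw [dist_comm t.2 t.1] at *
    rw [abs_le]
    constructor <;> linarith
  · have := hν.le.trans hπ
    rw [htsum, tsub_le_iff_right] at this
    have h := ENNReal.toReal_mono (by simp) this
    rw [ENNReal.toReal_add (measure_ne_top _ _) ENNReal.coe_ne_top] at h
    simp only [ENNReal.toReal_one, ENNReal.coe_toReal] at h
    rw [measureReal_def]
    linarith

end OfMeasure

theorem support_subset_iff_of_isClosed {E : Type*} [TopologicalSpace E] [SecondCountableTopology E]
    [MeasurableSpace E] {μ : Measure E} {K : Set E} (hK : IsClosed K) :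
    μ.support ⊆ K ↔ ∀ᵐ x ∂μ, x ∈ K :=
  ⟨fun h => mem_of_superset μ.support_mem_ae h, fun h => Measure.support_subset_of_isClosed hK h⟩

theorem mk_ofMeasure_mem_ballClasses {N : ℕ} {R : ℝ} {μ : Measure (Fin N → ℝ)}
    [IsProbabilityMeasure μ] (h : ∀ᵐ x ∂μ, ‖x‖ ≤ R) : mk (ofMeasure μ) ∈ ballClasses N R :=
  ⟨μ, inferInstance, (support_subset_iff_of_isClosed
    (isClosed_le continuous_norm continuous_const)).2 h, rfl⟩

theorem isCompact_ballClasses (N : ℕ) (R : ℝ) : IsCompact (ballClasses N R) := by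
  have h : IsCompact {μ : ProbabilityMeasure (Fin N → ℝ) |
      ∀ _ : ℕ, μ (Metric.closedBall 0 R)ᶜ ≤ 0} :=
    isCompact_setOfPred_probabilityMeasure_mass_eq_compl_isCompact_le (u := fun _ => 0)
      tendsto_const_nhds (fun _ => isCompact_closedBall 0 R) (Or.inl inferInstance)
  convert! h.image continuous_mk_ofMeasure
  ext X
  have hcl : IsClosed {x : Fin N → ℝ | ‖x‖ ≤ R} := isClosed_le continuous_norm continuous_const
  have key : ∀ μ : ProbabilityMeasure (Fin N → ℝ),
      (∀ _ : ℕ, μ (Metric.closedBall 0 R)ᶜ ≤ 0) ↔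
        (μ : Measure (Fin N → ℝ)).support ⊆ {x | ‖x‖ ≤ R} := by
    intro μ
    rw [support_subset_iff_of_isClosed hcl, forall_const, nonpos_iff_eq_zero,
      ProbabilityMeasure.null_iff_toMeasure_null, ae_iff]
    have : (Metric.closedBall (0 : Fin N → ℝ) R)ᶜ = {x | ¬ x ∈ {x : Fin N → ℝ | ‖x‖ ≤ R}} := by
      ext x; simp
    rw [this]
  constructor
  · rintro ⟨μ, hμ, hs, rfl⟩
    exact ⟨⟨μ, hμ⟩, (key ⟨μ, hμ⟩).2 hs, rfl⟩
  · rintro ⟨μ, hμ, rfl⟩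
    exact ⟨μ, inferInstance, (key μ).1 hμ, rfl⟩

end MMClass

/-! ### Lipschitz order and finite-dimensional approximation -/

namespace MMSpace

section OfMeasure

variable {E : Type} [MetricSpace E] [MeasurableSpace E] [BorelSpace E]

/-- Full support of `X` gives this for every point, not just almost every one; this is what lets a
Lipschitz map be corestricted to the support. -/
theorem mem_support_of_map_eq {X : MMSpace} {f : X → E} (hf : Continuous f) {ν : Measure E}
    (h : X.μ.map f = ν) (x : X) : f x ∈ ν.support := by
  rw [Measure.mem_support_iff_forall]
  intro U hU
  have hx : x ∈ X.μ.support := by rw [X.support_eq]; trivial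
  have := (Measure.mem_support_iff_forall _).1 hx _ (hf.continuousAt.preimage_mem_nhds hU)
  rw [← h]
  exact this.trans_le (Measure.le_map_apply hf.measurable.aemeasurable U)

variable [CompleteSpace E] [TopologicalSpace.SeparableSpace E]

theorem ofMeasure_prec_iff {X : MMSpace} {ν : Measure E} [IsProbabilityMeasure ν] :
    (ofMeasure ν).Prec X ↔ ∃ f : X → E, LipschitzWith 1 f ∧ X.μ.map f = ν := by
  have hm : Measurable (Subtype.val : ν.support → E) := measurable_subtype_coe
  constructor
  · rintro ⟨f, hf, hfν⟩
    refine ⟨fun x => (f x : ν.support).1, ?_, ?_⟩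
    · simpa using! (isometry_val_ofMeasure ν).lipschitz.comp hf
    · exact (Measure.map_map hm hf.continuous.measurable).symm.trans
        ((congrArg (Measure.map (Subtype.val : ν.support → E)) hfν).trans (map_val_ofMeasure ν))
  · rintro ⟨f, hf, hfν⟩
    have hs := mem_support_of_map_eq hf.continuous hfν
    have hF : Measurable fun x => (⟨f x, hs x⟩ : ν.support) :=
      hf.continuous.measurable.subtype_mk
    refine ⟨fun x => (⟨f x, hs x⟩ : ν.support), fun x y => hf x y, ?_⟩
    have he : MeasurableEmbedding (Subtype.val : ν.support → E) :=
      .subtype_coe ν.isClosed_support.measurableSet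
    refine (he.comap_map (X.μ.map fun x => (⟨f x, hs x⟩ : ν.support))).symm.trans ?_
    rw [Measure.map_map hm hF]
    exact congrArg (Measure.comap Subtype.val) hfν

end OfMeasure

/-- Transfer of a bounded `1`-Lipschitz function along a correspondence of small distortion. -/
theorem exists_lipschitzWith_transfer {X Y : MMSpace} {S : Set (X × Y)} {ε : ℝ}
    (hd : ∀ p ∈ S, ∀ q ∈ S, |dist p.1 q.1 - dist p.2 q.2| ≤ ε) {u : X → ℝ} {R : ℝ}
    (hu : LipschitzWith 1 u) (huR : ∀ x, |u x| ≤ R) :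
    ∃ v : Y → ℝ, LipschitzWith 1 v ∧ (∀ y, |v y| ≤ R) ∧ ∀ p ∈ S, |u p.1 - v p.2| ≤ ε := by
  rcases S.eq_empty_or_nonempty with rfl | hS
  · exact ⟨fun _ => u (Classical.arbitrary X), LipschitzWith.const' _, fun _ => huR _, by simp⟩
  have : Nonempty S := hS.to_subtype
  have hR : 0 ≤ R := (abs_nonneg _).trans (huR (Classical.arbitrary X))
  have hlow : ∀ y (p : S), -R ≤ u p.1.1 + dist y p.1.2 := fun y p => by
    have := (abs_le.1 (huR p.1.1)).1
    have := dist_nonneg (x := y) (y := p.1.2)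
    linarith
  have hbdd : ∀ y, BddBelow (range fun p : S => u p.1.1 + dist y p.1.2) := fun y =>
    ⟨-R, by rintro _ ⟨p, rfl⟩; exact hlow y p⟩
  -- McShane's formula along the correspondence, truncated at `R`; on points matched by `S` the
  -- truncation is inactive.
  refine ⟨fun y => min R (⨅ p : S, u p.1.1 + dist y p.1.2), ?_, fun y => ?_, fun p hp => ?_⟩
  · refine LipschitzWith.const_min (LipschitzWith.of_le_add fun y z => ?_) R
    rw [← sub_le_iff_le_add]
    refine le_ciInf fun p => ?_
    have h1 := ciInf_le (hbdd y) p
    have h2 := dist_triangle y z p.1.2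
    linarith
  · rw [abs_le]
    exact ⟨le_min (by linarith) (le_ciInf (hlow y)), min_le_left _ _⟩
  · have h1 := ciInf_le (hbdd p.2) ⟨p, hp⟩
    simp only [dist_self, add_zero] at h1
    beta_reduce
    rw [min_eq_right (h1.trans (abs_le.1 (huR _)).2), abs_le]
    have hε : 0 ≤ ε := (abs_nonneg _).trans (hd p hp p hp)
    refine ⟨by linarith, ?_⟩
    rw [sub_le_comm]
    refine le_ciInf fun q => ?_
    have h2 := (abs_le.1 (hd p hp _ q.2)).2
    have h3 := (abs_le.1 ((Real.dist_eq _ _).symm.trans_le (hu.dist_le_mul p.1 q.1.1))).2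
    simp only [NNReal.coe_one, one_mul] at h3
    linarith

end MMSpace

namespace MMClass

open MMSpace

/-- In the sup norm a map is `1`-Lipschitz as soon as its coordinates are, so a map from `X` can be
transferred to `Y` coordinatewise. Matched points have images within `ε`, and comparing two pairs
doubles the error, whatever `N` is. -/
theorem exists_mem_ballClasses_prec_edist_le {N : ℕ} {R : ℝ} {X X' Y : MMClass} {δ : ℝ≥0∞}
    (hX' : X' ∈ ballClasses N R) (hp : X'.Prec X) (hδ : edist X Y < δ) :
    ∃ Y' ∈ ballClasses N R, Y'.Prec Y ∧ edist X' Y' ≤ 2 * δ := by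
  obtain ⟨X, rfl⟩ := mk_surjective X
  obtain ⟨Y, rfl⟩ := mk_surjective Y
  obtain ⟨ν, hν, hsupp, rfl⟩ := hX'
  obtain ⟨f, hf, hfν⟩ := ofMeasure_prec_iff.1 hp
  have hfR : ∀ x i, |f x i| ≤ R := fun x i =>
    (norm_le_pi_norm (f x) i).trans (hsupp (mem_support_of_map_eq hf.continuous hfν x))
  have hR : 0 ≤ R := (norm_nonneg (f (Classical.arbitrary X))).trans
    (hsupp (mem_support_of_map_eq hf.continuous hfν _))
  obtain ⟨ε, π, S, hεδ, _, h1, h2, hS, hd, hm⟩ := exists_coupling_of_box_lt hδ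
  have hfi : ∀ i, LipschitzWith 1 fun x => f x i := fun i => by
    simpa using! (LipschitzWith.eval i).comp hf
  choose g hg hgR hgS using fun i => exists_lipschitzWith_transfer hd (hfi i) (fun x => hfR x i)
  have hG : LipschitzWith 1 fun y i => g i y := LipschitzWith.of_dist_le_mul fun y z => by
    refine (dist_pi_le_iff (by positivity)).2 fun i => (hg i).dist_le_mul y z
  have hGm := hG.continuous.measurable
  have : IsProbabilityMeasure (Y.μ.map fun y i => g i y) :=
    Measure.isProbabilityMeasure_map hGm.aemeasurable
  refine ⟨mk (ofMeasure (Y.μ.map fun y i => g i y)), mk_ofMeasure_mem_ballClasses ?_,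
    ofMeasure_prec_iff.2 ⟨_, hG, rfl⟩, ?_⟩
  · refine (ae_map_iff hGm.aemeasurable (p := fun x => ‖x‖ ≤ R)
      (measurableSet_le measurable_norm measurable_const)).2 (.of_forall fun y => ?_)
    exact (pi_norm_le_iff_of_nonneg hR).2 fun i => hgR i y
  · refine le_trans ?_ (mul_le_mul_right hεδ.le 2)
    have key : MMSpace.box (ofMeasure ν) (ofMeasure (Y.μ.map fun y i => g i y)) ≤ (2 * ε : ℝ≥0) := by
      refine box_le_of_isometries (P := π) (isometry_val_ofMeasure _) (isometry_val_ofMeasure _)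
        (hf.continuous.measurable.comp measurable_fst) (hGm.comp measurable_snd) ?_ ?_ (S := S)
        ?_ ?_
      · refine Eq.trans ?_ (map_val_ofMeasure _).symm
        rw [← Measure.map_map hf.continuous.measurable measurable_fst, ← hfν, ← h1]
        rfl
      · refine Eq.trans ?_ (map_val_ofMeasure _).symm
        rw [← Measure.map_map hGm measurable_snd, ← h2]
        rfl
      · have hdist : ∀ p ∈ S, dist (f p.1) (fun i => g i p.2) ≤ ε := fun p hp =>
          (dist_pi_le_iff ε.2).2 fun i => hgS i p hp
        intro p hp q hq
        have e1 := hdist p hp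
        have e2 := hdist q hq
        have t1 := dist_triangle4 (f p.1) (fun i => g i p.2) (fun i => g i q.2) (f q.1)
        have t2 := dist_triangle4 (fun i => g i p.2) (f p.1) (f q.1) (fun i => g i q.2)
        rw [dist_comm (fun i => g i q.2) (f q.1)] at t1
        rw [dist_comm (fun i => g i p.2) (f p.1)] at t2
        simp only [Function.comp_apply]
        push_cast
        rw [abs_le]
        constructor <;> linarith
      · push_cast
        linarith [ε.2, (show (0 : ℝ) ≤ ε from ε.2)]
    exact_mod_cast key

/-- Every mm-space is approximated by images under bounded distance coordinates. -/
theorem exists_mem_ballClasses_prec_edist_lt (X : MMClass) {δ : ℝ≥0∞} (hδ : 0 < δ) :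
    ∃ k : ℕ, 1 ≤ k ∧ ∃ X' ∈ ballClasses k k, X'.Prec X ∧ edist X X' < δ := by
  obtain ⟨X, rfl⟩ := mk_surjective X
  obtain ⟨ε, hε, hεδ⟩ := ENNReal.lt_iff_exists_nnreal_btwn.1 hδ
  have hε : 0 < (ε : ℝ) := by exact_mod_cast hε
  set a := TopologicalSpace.denseSeq X with ha
  have hcov : (⋃ m, accumulate (fun n => Metric.ball (a n) (ε / 2)) m) = univ := by
    rw [iUnion_accumulate]
    refine eq_univ_of_forall fun x => ?_
    obtain ⟨n, hn⟩ := (TopologicalSpace.denseRange_denseSeq X).exists_dist_lt x (half_pos hε)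
    exact mem_iUnion.2 ⟨n, hn⟩
  have hlim : Tendsto (fun m => X.μ.real (accumulate (fun n => Metric.ball (a n) (ε / 2)) m))
      atTop (𝓝 1) := by
    have := tendsto_measure_iUnion_atTop (μ := X.μ)
      (monotone_accumulate (s := fun n => Metric.ball (a n) ((ε : ℝ) / 2)))
    rw [hcov, measure_univ] at this
    exact (ENNReal.tendsto_toReal ENNReal.one_ne_top).comp this
  obtain ⟨m, hm⟩ := (hlim.eventually (lt_mem_nhds (sub_lt_self 1 hε))).exists
  obtain ⟨R, hR⟩ : ∃ R : ℝ, ∀ i ≤ m, ∀ j ≤ m, dist (a i) (a j) ≤ R := by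
    obtain ⟨R, hR⟩ := ((finite_Iic m).image2 (fun i j => dist (a i) (a j)) (finite_Iic m)).bddAbove
    exact ⟨R, fun i hi j hj => hR (mem_image2_of_mem hi hj)⟩
  -- Room for the `m + 1` centres as coordinates, and a level high enough for the truncation to be
  -- inactive near them.
  set k := max (m + 1) ⌈R + ε⌉₊ with hk
  have hkR : R + ε ≤ k := (Nat.le_ceil _).trans (by exact_mod_cast le_max_right _ _)
  have hkm : m < k := lt_of_lt_of_le (Nat.lt_succ_self m) (le_max_left _ _)
  set F : X → Fin k → ℝ := fun x i => min (dist x (a i)) k with hF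
  have hFl : LipschitzWith 1 F := LipschitzWith.of_dist_le_mul fun x y => by
    refine (dist_pi_le_iff (by positivity)).2 fun i => ?_
    exact ((LipschitzWith.dist_left (a i)).min_const (k : ℝ)).dist_le_mul x y
  have hFm := hFl.continuous.measurable
  have : IsProbabilityMeasure (X.μ.map F) := Measure.isProbabilityMeasure_map hFm.aemeasurable
  refine ⟨k, by omega, mk (ofMeasure (X.μ.map F)), mk_ofMeasure_mem_ballClasses ?_,
    ofMeasure_prec_iff.2 ⟨_, hFl, rfl⟩, lt_of_le_of_lt ?_ hεδ⟩
  · refine (ae_map_iff hFm.aemeasurable (p := fun x => ‖x‖ ≤ (k : ℝ))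
      (measurableSet_le measurable_norm measurable_const)).2 (.of_forall fun x => ?_)
    refine (pi_norm_le_iff_of_nonneg (by positivity)).2 fun i => ?_
    rw [Real.norm_eq_abs, abs_of_nonneg (le_min dist_nonneg (by positivity))]
    exact min_le_right _ _
  · refine box_le_of_isometries (P := X.μ) isometry_id (isometry_val_ofMeasure _) measurable_id hFm
      rfl (map_val_ofMeasure _).symm
      (S := accumulate (fun n => Metric.ball (a n) ((ε : ℝ) / 2)) m) ?_ hm.le
    intro x hx y hy
    obtain ⟨i, hi, hxi⟩ := mem_accumulate.1 hx
    obtain ⟨j, hj, hyj⟩ := mem_accumulate.1 hy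
    rw [Metric.mem_ball] at hxi hyj
    have h1 : dist (F x) (F y) ≤ dist x y := by simpa using hFl.dist_le_mul x y
    -- The coordinate of a centre within `ε / 2` of `x` alone recovers `dist x y` up to `ε`.
    have h2 : dist (F x ⟨i, hi.trans_lt hkm⟩) (F y ⟨i, hi.trans_lt hkm⟩) ≤ dist (F x) (F y) :=
      dist_le_pi_dist _ _ _
    have h3 : F y ⟨i, hi.trans_lt hkm⟩ = dist y (a i) := by
      refine min_eq_left ?_
      have := dist_triangle y (a j) (a i)
      have := hR j hj i hi
      linarith
    have h4 : F x ⟨i, hi.trans_lt hkm⟩ ≤ dist x (a i) := min_le_left _ _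
    rw [Real.dist_eq, abs_sub_comm] at h2
    have h5 := (le_abs_self _).trans h2
    have h6 := dist_triangle x (a i) y
    rw [dist_comm (a i) y] at h6
    simp only [id]
    rw [abs_le]
    constructor <;> linarith

end MMClass

/-! ### Couplings near a jointly dominated space -/

namespace MMSpace

/-- If `X₁`, `X₁'` are dominated by `Z` and are box-close to `X`, `X'`, then some coupling of `X`
and `X'` is box-close to a space dominated by `Z`. -/
theorem exists_coupling_box_le {X X' X₁ X₁' Z : MMSpace} (h₁ : X₁.Prec Z) (h₁' : X₁'.Prec Z)
    {δ : ℝ≥0∞} (hδ : box X X₁ < δ) (hδ' : box X' X₁' < δ) :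
    ∃ (π : Measure (X × X')) (_ : IsProbabilityMeasure π) (W : MMSpace), π.fst = X.μ ∧
      π.snd = X'.μ ∧ W.Prec Z ∧ box (ofMeasure π) W ≤ 2 * δ := by
  obtain ⟨f, hf, hfμ⟩ := h₁
  obtain ⟨f', hf', hfμ'⟩ := h₁'
  have hfm := hf.continuous.measurable
  have hfm' := hf'.continuous.measurable
  obtain ⟨ε, π, S, hεδ, _, hX, hX₁, hS, hd, hm⟩ := exists_coupling_of_box_lt hδ
  obtain ⟨ε', π', S', hεδ', _, hX', hX₁', hS', hd', hm'⟩ := exists_coupling_of_box_lt hδ'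
  -- Two gluings build the chain `X`, `X₁`, `Z`, `X₁'`, `X'` on one probability space; its end
  -- points give the coupling, and the image of `Z` under `(f, f')` gives `W`.
  obtain ⟨γ, _, hγ₁, hγ₂, hγ⟩ := exists_coupling_ae_eq (α := π) (β := Z.μ) (f := Prod.snd) (g := f)
    measurable_snd hfm (hX₁.trans hfμ.symm)
  have hγZ : γ.map (fun p => f' p.2) = X₁'.μ := by
    rw [← hfμ', ← hγ₂, Measure.snd, Measure.map_map hfm' measurable_snd]
    rfl
  obtain ⟨η, _, hη₁, hη₂, hη⟩ := exists_coupling_ae_eq (α := γ) (β := π')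
    (f := fun p => f' p.2) (g := Prod.snd) (hfm'.comp measurable_snd) measurable_snd
    (hγZ.trans hX₁'.symm)
  have hηγ : ∀ᵐ p ∂η, p.1.1.2 = f p.1.2 := by
    rw [← hη₁] at hγ
    exact ae_of_ae_map measurable_fst.aemeasurable hγ
  have hFm : Measurable fun p : ((X × X₁) × Z) × (X' × X₁') => (p.1.1.1, p.2.1) := by fun_prop
  have hGl : LipschitzWith 1 fun z : Z => (f z, f' z) := by simpa using hf.prodMk hf'
  have hGm := hGl.continuous.measurable
  have : IsProbabilityMeasure (η.map fun p => (p.1.1.1, p.2.1)) :=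
    Measure.isProbabilityMeasure_map hFm.aemeasurable
  have : IsProbabilityMeasure (Z.μ.map fun z => (f z, f' z)) :=
    Measure.isProbabilityMeasure_map hGm.aemeasurable
  refine ⟨η.map fun p => (p.1.1.1, p.2.1), inferInstance,
    ofMeasure (Z.μ.map fun z => (f z, f' z)), ?_, ?_, ofMeasure_prec_iff.2 ⟨_, hGl, rfl⟩, ?_⟩
  · rw [Measure.fst, Measure.map_map measurable_fst hFm, ← hX, ← hγ₁, ← hη₁]
    simp only [Measure.fst]
    rw [Measure.map_map measurable_fst measurable_fst,
      Measure.map_map (measurable_fst.comp measurable_fst) measurable_fst]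
    rfl
  · rw [Measure.snd, Measure.map_map measurable_snd hFm, ← hX', ← hη₂, Measure.snd, Measure.fst,
      Measure.map_map measurable_fst measurable_snd]
    rfl
  · have key : box (ofMeasure (η.map fun p => (p.1.1.1, p.2.1)))
        (ofMeasure (Z.μ.map fun z => (f z, f' z))) ≤ (ε + ε' : ℝ≥0) := by
      refine box_le_of_isometries (P := η) (isometry_val_ofMeasure _) (isometry_val_ofMeasure _)
        hFm (hGm.comp (measurable_snd.comp measurable_fst)) (map_val_ofMeasure _).symm
        (Eq.trans ?_ (map_val_ofMeasure _).symm)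
        (S := ((fun p => p.1.1) ⁻¹' S ∩ Prod.snd ⁻¹' S') ∩
          {p | p.1.1.2 = f p.1.2 ∧ f' p.1.2 = p.2.2}) ?_ ?_
      · rw [← Measure.map_map hGm (measurable_snd.comp measurable_fst),
          ← Measure.map_map measurable_snd measurable_fst, ← hγ₂, ← hη₁]
        rfl
      · rintro s ⟨⟨hs, hs'⟩, hs1, hs2⟩ t ⟨⟨ht, ht'⟩, ht1, ht2⟩
        have e1 := hd _ hs _ ht
        have e2 := hd' _ hs' _ ht'
        simp only [Function.comp_apply, Prod.dist_eq]
        rw [← hs1, ← ht1, hs2, ht2]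
        refine (abs_max_sub_max_le_max _ _ _ _).trans (max_le ?_ ?_)
        · push_cast
          linarith [(show (0 : ℝ) ≤ ε' from ε'.2)]
        · push_cast
          linarith [(show (0 : ℝ) ≤ ε from ε.2)]
      · have h0 : η.real (((fun p => p.1.1) ⁻¹' S ∩ Prod.snd ⁻¹' S') ∩
            {p | p.1.1.2 = f p.1.2 ∧ f' p.1.2 = p.2.2}) =
            η.real ((fun p => p.1.1) ⁻¹' S ∩ Prod.snd ⁻¹' S') := by
          refine measureReal_congr ?_
          filter_upwards [hηγ, hη] with p hp hp'
          exact propext ⟨fun h => h.1, fun h => ⟨h, hp, hp'⟩⟩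
        rw [h0]
        push_cast
        refine le_measureReal_inter (measurable_snd hS') ?_ ?_
        · refine hm.trans_eq ?_
          have hmm : Measurable fun p : ((X × X₁) × Z) × (X' × X₁') => p.1.1 :=
            measurable_fst.comp measurable_fst
          rw [← map_measureReal_apply hmm hS, ← hγ₁, ← hη₁, Measure.fst, Measure.fst,
            Measure.map_map measurable_fst measurable_fst]
          rfl
        · refine hm'.trans_eq ?_
          rw [← map_measureReal_apply measurable_snd hS', ← hη₂]
          rfl
    refine key.trans ?_
    rw [two_mul, ENNReal.coe_add]
    exact add_le_add hεδ.le hεδ'.le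

theorem prec_ofMeasure_of_map_eq {E : Type} [MetricSpace E] [CompleteSpace E]
    [TopologicalSpace.SeparableSpace E] [MeasurableSpace E] [BorelSpace E] {μ : Measure E}
    [IsProbabilityMeasure μ] {X : MMSpace} {f : E → X} (hf : LipschitzWith 1 f)
    (h : μ.map f = X.μ) : X.Prec (ofMeasure μ) := by
  refine ⟨fun x => f (Subtype.val (p := (· ∈ μ.support)) x),
    by simpa using! hf.comp (isometry_val_ofMeasure μ).lipschitz, ?_⟩
  rw [← h]
  conv_rhs => rw [← map_val_ofMeasure μ]
  exact (Measure.map_map hf.continuous.measurable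
    (isometry_val_ofMeasure μ).continuous.measurable).symm

end MMSpace

namespace MMClass

open MMSpace

theorem Prec.refl (X : MMClass) : X.Prec X := by
  obtain ⟨X, rfl⟩ := mk_surjective X
  exact (Iso.refl X).prec

theorem exists_coupling_edist_le {X X' : MMSpace} {X₁ X₁' Z : MMClass} (h₁ : X₁.Prec Z)
    (h₁' : X₁'.Prec Z) {δ : ℝ≥0∞} (hδ : edist (mk X) X₁ < δ) (hδ' : edist (mk X') X₁' < δ) :
    ∃ π : ProbabilityMeasure (X × X'), ((π : Measure (X × X')).fst = X.μ ∧
      (π : Measure (X × X')).snd = X'.μ) ∧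
      ∃ W, Prec W Z ∧ edist (mk (ofMeasure (π : Measure (X × X')))) W ≤ 2 * δ := by
  obtain ⟨X₁, rfl⟩ := mk_surjective X₁
  obtain ⟨X₁', rfl⟩ := mk_surjective X₁'
  obtain ⟨Z, rfl⟩ := mk_surjective Z
  obtain ⟨π, hπ, W, h1, h2, hW, hb⟩ := exists_coupling_box_le h₁ h₁' hδ hδ'
  exact ⟨⟨π, hπ⟩, ⟨h1, h2⟩, mk W, hW, hb⟩

/-- The one-point space is the witness; it makes every slice of a pyramid nonempty, so that
Hausdorff distances of slices are bounded. -/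
theorem exists_mem_forall_prec {R : ℝ} (hR : 0 ≤ R) (N : ℕ) :
    ∃ X ∈ ballClasses N R, ∀ Y, Prec X Y := by
  refine ⟨mk (ofMeasure (Measure.dirac 0)), mk_ofMeasure_mem_ballClasses ?_, fun Y => ?_⟩
  · simp [ae_dirac_eq, hR]
  · obtain ⟨Y, rfl⟩ := mk_surjective Y
    exact ofMeasure_prec_iff.2 ⟨fun _ => 0, LipschitzWith.const' _, by simp⟩

end MMClass

/-! ### Limits of pyramids along ultrafilters -/

namespace Pyramid

open MMClass Metric

theorem infEDist_carrier_le_one (X : MMClass) (P : Pyramid) : infEDist X P.carrier ≤ 1 := by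
  obtain ⟨Y, hY⟩ := P.nonempty
  exact (infEDist_le_edist_of_mem hY).trans (edist_le_one X Y)

theorem inter_ballClasses_nonempty (P : Pyramid) (k : ℕ) :
    (P.carrier ∩ ballClasses k k).Nonempty := by
  obtain ⟨Y, hY⟩ := P.nonempty
  obtain ⟨X, hX, hXp⟩ := exists_mem_forall_prec (Nat.cast_nonneg (α := ℝ) k) k
  exact ⟨X, P.lower Y hY X (hXp Y), hX⟩

/-- Choose `Y` in `P` near `X`; the transferred space is dominated by `Y`, hence lies in `P`. With
`X' = X` this compares a pyramid with its slice. -/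
theorem infEDist_inter_ballClasses_le (P : Pyramid) {N : ℕ} {R : ℝ} {X X' : MMClass}
    (hX' : X' ∈ ballClasses N R) (hp : X'.Prec X) :
    infEDist X' (P.carrier ∩ ballClasses N R) ≤ 2 * infEDist X P.carrier := by
  rw [mul_comm, ← ENNReal.div_le_iff_le_mul (.inl two_ne_zero) (.inl ENNReal.ofNat_ne_top)]
  refine le_of_forall_gt_imp_ge_of_dense fun δ hδ => ?_
  obtain ⟨Y, hY, hXY⟩ := infEDist_lt_iff.1 hδ
  obtain ⟨Y', hY', hY'Y, hle⟩ := exists_mem_ballClasses_prec_edist_le hX' hp hXY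
  rw [ENNReal.div_le_iff_le_mul (.inl two_ne_zero) (.inl ENNReal.ofNat_ne_top), mul_comm]
  exact (infEDist_le_edist_of_mem (mem_inter (P.lower Y hY Y' hY'Y) hY')).trans hle

/-- Finite-dimensional approximants of `Y` are also dominated by `X`, which reduces to the previous
estimate. It makes limits of pyramids downward closed. -/
theorem infEDist_le_of_prec (P : Pyramid) {X Y : MMClass} (h : Y.Prec X) :
    infEDist Y P.carrier ≤ 2 * infEDist X P.carrier := by
  refine ENNReal.le_of_forall_pos_le_add fun ε hε _ => ?_
  obtain ⟨k, -, X', hX', hX'Y, hlt⟩ := exists_mem_ballClasses_prec_edist_lt Y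
    (ENNReal.coe_pos.2 hε)
  calc infEDist Y P.carrier ≤ infEDist X' P.carrier + edist Y X' :=
        infEDist_le_infEDist_add_edist
    _ ≤ 2 * infEDist X P.carrier + ε :=
        add_le_add ((infEDist_anti inter_subset_left).trans
          (P.infEDist_inter_ballClasses_le hX' (hX'Y.trans h))) hlt.le

section Limit

variable {ι : Type*} {P : ι → Pyramid}

/-- Directedness of each `P i` gives a coupling of `X` and `X'` close to `P i`. These couplings
converge along `V` by compactness, and the limit dominates `X` and `X'` by its projections. The
slack `e` is there because the distances to `P i` need not be attained. -/
theorem exists_dominating_of_ultrafilter {V : Ultrafilter ι} {e : ι → ℝ≥0∞} (he₀ : ∀ i, 0 < e i)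
    (he : Tendsto e V (𝓝 0)) {X X' : MMClass}
    (hX : Tendsto (fun i => infEDist X (P i).carrier) V (𝓝 0))
    (hX' : Tendsto (fun i => infEDist X' (P i).carrier) V (𝓝 0)) :
    ∃ Z : MMClass, X.Prec Z ∧ X'.Prec Z ∧
      Tendsto (fun i => infEDist Z (P i).carrier) V (𝓝 0) := by
  obtain ⟨X, rfl⟩ := mk_surjective X
  obtain ⟨X', rfl⟩ := mk_surjective X'
  set d : ι → ℝ≥0∞ := fun i =>
    infEDist (MMClass.mk X) (P i).carrier + infEDist (MMClass.mk X') (P i).carrier + e i with hd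
  have hd0 : Tendsto (fun i => 2 * d i) V (𝓝 0) := by
    have := ENNReal.Tendsto.const_mul (a := 2) ((hX.add hX').add he) (.inr ENNReal.ofNat_ne_top)
    simpa only [add_zero, mul_zero] using this
  have hlt : ∀ a b c : ℝ≥0∞, a ≤ 1 → 0 < c → a < a + b + c := fun a b c ha hc =>
    (ENNReal.lt_add_right (ne_top_of_le_ne_top ENNReal.one_ne_top ha) hc.ne').trans_le
      (add_le_add_left le_self_add c)
  have hex : ∀ i, ∃ π : ProbabilityMeasure (X × X'), ((π : Measure (X × X')).fst = X.μ ∧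
      (π : Measure (X × X')).snd = X'.μ) ∧
      infEDist (MMClass.mk (MMSpace.ofMeasure (π : Measure (X × X')))) (P i).carrier ≤ 2 * d i := by
    intro i
    obtain ⟨X₁, hX₁, h₁⟩ := infEDist_lt_iff.1
      (hlt _ (infEDist (MMClass.mk X') (P i).carrier) _ (infEDist_carrier_le_one (MMClass.mk X) (P i)) (he₀ i))
    obtain ⟨X₁', hX₁', h₁'⟩ := infEDist_lt_iff.1
      (hlt _ (infEDist (MMClass.mk X) (P i).carrier) _ (infEDist_carrier_le_one (MMClass.mk X') (P i)) (he₀ i))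
    rw [add_comm (infEDist (MMClass.mk X') _)] at h₁'
    obtain ⟨Z, hZ, hZ₁, hZ₁'⟩ := (P i).directed X₁ hX₁ X₁' hX₁'
    obtain ⟨π, hπ, W, hW, hle⟩ := exists_coupling_edist_le hZ₁ hZ₁' h₁ h₁'
    exact ⟨π, hπ, (infEDist_le_edist_of_mem ((P i).lower Z hZ W hW)).trans hle⟩
  choose π hπ hπd using hex
  obtain ⟨π₀, ⟨h1, h2⟩, hlim⟩ := (isCompact_setOf_couplings ⟨X.μ, inferInstance⟩
    ⟨X'.μ, inferInstance⟩).ultrafilter_le_nhds (V.map π) (by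
      rw [le_principal_iff]
      exact Filter.mem_map.2 (univ_mem' hπ))
  refine ⟨MMClass.mk (MMSpace.ofMeasure (π₀ : Measure (X × X'))),
    MMSpace.prec_ofMeasure_of_map_eq LipschitzWith.prod_fst h1,
    MMSpace.prec_ofMeasure_of_map_eq LipschitzWith.prod_snd h2, ?_⟩
  have hc := (continuous_mk_ofMeasure.tendsto π₀).comp (show Tendsto π V (𝓝 π₀) from hlim)
  rw [tendsto_iff_edist_tendsto_0] at hc
  refine tendsto_of_tendsto_of_tendsto_of_le_of_le tendsto_const_nhds
    (by simpa using hd0.add hc) (fun _ => bot_le) fun i => ?_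
  refine infEDist_le_infEDist_add_edist.trans (add_le_add (hπd i) (le_of_eq ?_))
  exact edist_comm _ _

/-- The limit of pyramids along an ultrafilter. -/
theorem exists_mem_carrier_iff_tendsto (U : Ultrafilter Pyramid) :
    ∃ Q : Pyramid, ∀ X, X ∈ Q.carrier ↔
      Tendsto (fun P : Pyramid => infEDist X P.carrier) U (𝓝 0) := by
  refine ⟨⟨{X | Tendsto (fun P : Pyramid => infEDist X P.carrier) U (𝓝 0)}, ?_, ?_, ?_, ?_⟩,
    fun X => Iff.rfl⟩
  · intro X hX Y hY
    have := ENNReal.Tendsto.const_mul (a := 2) (show Tendsto _ _ _ from hX) (.inr ENNReal.ofNat_ne_top)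
    exact tendsto_of_tendsto_of_tendsto_of_le_of_le tendsto_const_nhds (by simpa using this)
      (fun _ => bot_le) fun P => P.infEDist_le_of_prec hY
  · intro X hX X' hX'
    set V : Ultrafilter (Pyramid × ℕ) := Ultrafilter.of ((U : Filter Pyramid) ×ˢ atTop)
    have hV : (V : Filter (Pyramid × ℕ)) ≤ (U : Filter Pyramid) ×ˢ atTop := Ultrafilter.of_le _
    have h1 : Tendsto Prod.fst (V : Filter (Pyramid × ℕ)) U := tendsto_fst.mono_left hV
    have h2 : Tendsto Prod.snd (V : Filter (Pyramid × ℕ)) atTop := tendsto_snd.mono_left hV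
    obtain ⟨Z, hXZ, hX'Z, hZ⟩ := exists_dominating_of_ultrafilter (P := Prod.fst) (V := V)
      (e := fun p => ((p.2 : ℝ≥0∞))⁻¹) (fun p => by simp)
      (ENNReal.tendsto_inv_nat_nhds_zero.comp h2) ((show Tendsto _ _ _ from hX).comp h1)
      ((show Tendsto _ _ _ from hX').comp h1)
    refine ⟨Z, ?_, hXZ, hX'Z⟩
    have hVU : V.map Prod.fst = U := Ultrafilter.eq_of_le h1
    rw [mem_ofPred_eq, ← hVU]
    exact tendsto_map'_iff.2 hZ
  · obtain ⟨X, -, hX⟩ := exists_mem_forall_prec (le_refl (0 : ℝ)) 0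
    refine ⟨X, tendsto_const_nhds.congr fun P => ?_⟩
    obtain ⟨Y, hY⟩ := P.nonempty
    exact (infEDist_zero_of_mem (P.lower Y hY X (hX Y))).symm
  · intro X hX
    refine ENNReal.tendsto_nhds_zero.2 fun ε hε => ?_
    obtain ⟨Y, hY, hlt⟩ := hX (ε / 2) (ENNReal.half_pos hε.ne')
    filter_upwards [ENNReal.tendsto_nhds_zero.1 (show Tendsto _ _ _ from hY) (ε / 2)
      (ENNReal.half_pos hε.ne')] with P hP
    calc infEDist X P.carrier ≤ infEDist Y P.carrier + edist X Y := infEDist_le_infEDist_add_edist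
      _ ≤ ε / 2 + ε / 2 := add_le_add hP hlt.le
      _ = ε := ENNReal.add_halves ε

/-- Weak convergence along an ultrafilter implies Hausdorff convergence of the intersections with
the classes of measures on balls. -/
theorem tendsto_hausdorffEDist_of_ultrafilter {U : Ultrafilter ι} {Q : Pyramid}
    (h : ∀ X, X ∈ Q.carrier ↔ Tendsto (fun i => infEDist X (P i).carrier) U (𝓝 0)) (k : ℕ) :
    Tendsto (fun i => hausdorffEDist ((P i).carrier ∩ ballClasses k k)
      (Q.carrier ∩ ballClasses k k)) U (𝓝 0) := by
  refine ENNReal.tendsto_nhds_zero.2 fun ε hε => ?_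
  have hε2 : 0 < ε / 2 := ENNReal.half_pos hε.ne'
  have hB : TotallyBounded (Q.carrier ∩ ballClasses k k) :=
    (isCompact_ballClasses k k).totallyBounded.subset inter_subset_right
  -- A finite net makes the pointwise convergence uniform on the slice of `Q`.
  obtain ⟨t, htQ, ht, htc⟩ := EMetric.totallyBounded_iff'.1 hB (ε / 2) hε2
  have h1 : ∀ᶠ i in U, ∀ X ∈ Q.carrier ∩ ballClasses k k,
      infEDist X ((P i).carrier ∩ ballClasses k k) ≤ ε := by
    have hev : ∀ᶠ i in U, ∀ Y ∈ t, infEDist Y ((P i).carrier ∩ ballClasses k k) ≤ ε / 2 := by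
      refine (eventually_all_finite ht).2 fun Y hY => ?_
      have := ENNReal.Tendsto.const_mul (a := 2) ((h Y).1 (htQ hY).1) (.inr ENNReal.ofNat_ne_top)
      rw [mul_zero] at this
      filter_upwards [ENNReal.tendsto_nhds_zero.1 this _ hε2] with i hi
      exact ((P i).infEDist_inter_ballClasses_le (htQ hY).2 (Prec.refl Y)).trans hi
    filter_upwards [hev] with i hi X hX
    obtain ⟨Y, hY, hXY⟩ := mem_iUnion₂.1 (htc hX)
    calc infEDist X ((P i).carrier ∩ ballClasses k k)
        ≤ infEDist Y ((P i).carrier ∩ ballClasses k k) + edist X Y :=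
          infEDist_le_infEDist_add_edist
      _ ≤ ε / 2 + ε / 2 := add_le_add (hi Y hY) (mem_eball.1 hXY).le
      _ = ε := ENNReal.add_halves ε
  have h2 : ∀ᶠ i in U, ∀ Y ∈ (P i).carrier ∩ ballClasses k k,
      infEDist Y (Q.carrier ∩ ballClasses k k) ≤ ε := by
    by_contra hcon
    rw [← Ultrafilter.eventually_not] at hcon
    have hex : ∀ i, ∃ Y, (¬ ∀ Y ∈ (P i).carrier ∩ ballClasses k k,
        infEDist Y (Q.carrier ∩ ballClasses k k) ≤ ε) → Y ∈ (P i).carrier ∩ ballClasses k k ∧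
        ε < infEDist Y (Q.carrier ∩ ballClasses k k) := by
      intro i
      by_cases hi : ∀ Y ∈ (P i).carrier ∩ ballClasses k k,
        infEDist Y (Q.carrier ∩ ballClasses k k) ≤ ε
      -- An arbitrary value where no bad point exists. The bad points converge along `U` in
      -- `ballClasses k k` to a point of `Q`, a contradiction.
      · exact ⟨(P i).nonempty.some, fun hn => (hn hi).elim⟩
      · push Not at hi
        obtain ⟨Y, hY⟩ := hi
        exact ⟨Y, fun _ => hY⟩
    choose Y hY using hex
    obtain ⟨Z, hZ, hlim⟩ := (isCompact_ballClasses k k).ultrafilter_le_nhds (U.map Y) (by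
      rw [le_principal_iff]
      refine Filter.mem_map.2 ?_
      filter_upwards [hcon] with i hi
      exact (hY i hi).1.2)
    have hc := tendsto_iff_edist_tendsto_0.1 (show Tendsto Y U (𝓝 Z) from hlim)
    have hZQ : Z ∈ Q.carrier := by
      rw [h]
      refine tendsto_of_tendsto_of_tendsto_of_le_of_le' tendsto_const_nhds hc
        (.of_forall fun _ => bot_le) ?_
      filter_upwards [hcon] with i hi
      rw [edist_comm]
      exact infEDist_le_edist_of_mem (hY i hi).1.1
    obtain ⟨i, hi, hi'⟩ := (hcon.and (ENNReal.tendsto_nhds_zero.1 hc ε hε)).exists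
    exact absurd ((infEDist_le_edist_of_mem (mem_inter hZQ hZ)).trans hi') (not_le.2 (hY i hi).2)
  filter_upwards [h1, h2] with i h1 h2
  exact hausdorffEDist_le_of_infEDist h2 h1

end Limit

/-! ### Finiteness and separation for `rho` -/

theorem hausdorffEDist_inter_ballClasses_le_one (P Q : Pyramid) (k : ℕ) :
    hausdorffEDist (P.carrier ∩ ballClasses k k) (Q.carrier ∩ ballClasses k k) ≤ 1 := by
  have key : ∀ (X : MMClass) (P : Pyramid), infEDist X (P.carrier ∩ ballClasses k k) ≤ 1 := by
    intro X P
    obtain ⟨Y, hY⟩ := P.inter_ballClasses_nonempty k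
    exact (infEDist_le_edist_of_mem hY).trans (edist_le_one X Y)
  exact hausdorffEDist_le_of_infEDist (fun X _ => key X Q) fun X _ => key X P

theorem rhoK_eq (k : ℕ) (P Q : Pyramid) :
    rhoK k P Q = (1 / (4 * (k : ℝ≥0∞))) *
      hausdorffEDist (P.carrier ∩ ballClasses k k) (Q.carrier ∩ ballClasses k k) := by
  rw [rhoK, boxHausdorff_eq_hausdorffEDist]

theorem rhoK_succ_le_one (k : ℕ) (P Q : Pyramid) : rhoK (k + 1) P Q ≤ 1 := by
  rw [rhoK_eq]
  refine mul_le_one' ?_ (hausdorffEDist_inter_ballClasses_le_one P Q _)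
  rw [one_div, ENNReal.inv_le_one]
  exact_mod_cast (by omega : 1 ≤ 4 * (k + 1))

theorem tsum_inv_two_pow_succ : ∑' k : ℕ, ((2 : ℝ≥0∞) ^ (k + 1))⁻¹ = 1 := by
  simp_rw [ENNReal.inv_pow]
  rw [ENNReal.tsum_geometric_add_one, ENNReal.one_sub_inv_two, inv_inv]
  exact ENNReal.inv_mul_cancel two_ne_zero ENNReal.ofNat_ne_top

theorem rho_term_le (k : ℕ) (P Q : Pyramid) :
    ((2 : ℝ≥0∞) ^ (k + 1))⁻¹ * rhoK (k + 1) P Q ≤ ((2 : ℝ≥0∞) ^ (k + 1))⁻¹ :=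
  mul_le_of_le_one_right' (rhoK_succ_le_one k P Q)

theorem rho_le_one (P Q : Pyramid) : rho P Q ≤ 1 := by
  rw [← tsum_inv_two_pow_succ]
  exact ENNReal.tsum_le_tsum fun k => rho_term_le k P Q

/-- The weight of the `k`-th Hausdorff distance in `rho`. -/
noncomputable def weight (k : ℕ) : ℝ≥0∞ :=
  ((2 : ℝ≥0∞) ^ (k + 1))⁻¹ * (1 / (4 * ((k + 1 : ℕ) : ℝ≥0∞)))

theorem weight_ne_zero (k : ℕ) : weight k ≠ 0 := by
  refine mul_ne_zero (ENNReal.inv_ne_zero.2 (ENNReal.pow_ne_top ENNReal.ofNat_ne_top)) ?_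
  rw [one_div]
  exact ENNReal.inv_ne_zero.2 (ENNReal.mul_ne_top ENNReal.ofNat_ne_top (ENNReal.natCast_ne_top _))

theorem weight_ne_top (k : ℕ) : weight k ≠ ∞ := by
  refine ENNReal.mul_ne_top (ENNReal.inv_ne_top.2 (pow_ne_zero _ two_ne_zero)) ?_
  rw [one_div]
  refine ENNReal.inv_ne_top.2 (mul_ne_zero four_ne_zero ?_)
  exact_mod_cast k.succ_ne_zero

theorem rho_eq (P Q : Pyramid) : rho P Q = ∑' k : ℕ, weight k *
    hausdorffEDist (P.carrier ∩ ballClasses (k + 1) (k + 1 : ℕ))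
      (Q.carrier ∩ ballClasses (k + 1) (k + 1 : ℕ)) := by
  simp only [rho, rhoK_eq, weight, mul_assoc]

theorem weight_mul_hausdorffEDist_le (k : ℕ) (P Q : Pyramid) : weight k *
    hausdorffEDist (P.carrier ∩ ballClasses (k + 1) (k + 1 : ℕ))
      (Q.carrier ∩ ballClasses (k + 1) (k + 1 : ℕ)) ≤ ((2 : ℝ≥0∞) ^ (k + 1))⁻¹ := by
  have h := rho_term_le k P Q
  rwa [rhoK_eq, ← mul_assoc] at h

/-- The approximants of `X` lie in slices of `P`, hence at distance `0` from `Q`; closedness of `Q`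
concludes. -/
theorem mem_of_hausdorffEDist_eq_zero {P Q : Pyramid}
    (h : ∀ k : ℕ, hausdorffEDist (P.carrier ∩ ballClasses (k + 1) (k + 1 : ℕ))
      (Q.carrier ∩ ballClasses (k + 1) (k + 1 : ℕ)) = 0) {X : MMClass} (hX : X ∈ P.carrier) :
    X ∈ Q.carrier := by
  rw [mem_iff_infEDist_zero_of_closed Q.isClosed_carrier]
  refine nonpos_iff_eq_zero.1 (ENNReal.le_of_forall_pos_le_add fun ε hε _ => ?_)
  obtain ⟨k, hk, X', hX', hp, hlt⟩ := exists_mem_ballClasses_prec_edist_lt X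
    (ENNReal.coe_pos.2 hε)
  obtain ⟨k, rfl⟩ := Nat.exists_eq_add_of_le' hk
  calc infEDist X Q.carrier ≤ infEDist X' Q.carrier + edist X X' := infEDist_le_infEDist_add_edist
    _ ≤ 0 + ε := by
        refine add_le_add ?_ hlt.le
        rw [← h k]
        exact (infEDist_anti inter_subset_left).trans
          (infEDist_le_hausdorffEDist_of_mem ⟨P.lower X hX X' hp, hX'⟩)

/-- The extended metric `rho` on pyramids. -/
noncomputable abbrev emetricSpace : EMetricSpace Pyramid where
  edist := rho
  edist_self P := by simp [rho_eq]
  edist_comm P Q := by simp only [rho_eq, hausdorffEDist_comm]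
  edist_triangle P Q R := by
    simp only [rho_eq]
    rw [← ENNReal.tsum_add]
    refine ENNReal.tsum_le_tsum fun k => ?_
    rw [← mul_add]
    exact mul_le_mul_right hausdorffEDist_triangle _
  eq_of_edist_eq_zero {P Q} h := by
    change rho P Q = 0 at h
    rw [rho_eq, ENNReal.tsum_eq_zero] at h
    have h' := fun k => (mul_eq_zero.1 (h k)).resolve_left (weight_ne_zero k)
    ext X
    refine ⟨mem_of_hausdorffEDist_eq_zero h', mem_of_hausdorffEDist_eq_zero fun k => ?_⟩
    rw [hausdorffEDist_comm]
    exact h' k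

/-! ### The topology of `rho`: weak convergence and compactness -/

section Topology

attribute [local instance] emetricSpace

theorem edist_eq_rho (P Q : Pyramid) : edist P Q = rho P Q := rfl

/-- The terms of `rho` are bounded by a summable geometric sequence, so the tails are uniformly
small; conversely each term is at most `rho`, and its weight can be divided out. -/
theorem tendsto_nhds_iff_hausdorffEDist {ι : Type*} {F : Filter ι} {P : ι → Pyramid}
    {Q : Pyramid} : Tendsto P F (𝓝 Q) ↔ ∀ k : ℕ, Tendsto (fun i =>
      hausdorffEDist ((P i).carrier ∩ ballClasses (k + 1) (k + 1 : ℕ))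
        (Q.carrier ∩ ballClasses (k + 1) (k + 1 : ℕ))) F (𝓝 0) := by
  rw [tendsto_iff_edist_tendsto_0]
  simp only [edist_eq_rho]
  constructor
  · intro h k
    have h' := ENNReal.Tendsto.const_mul (a := (weight k)⁻¹) h
      (.inr (ENNReal.inv_ne_top.2 (weight_ne_zero k)))
    rw [mul_zero] at h'
    refine tendsto_of_tendsto_of_tendsto_of_le_of_le tendsto_const_nhds h' (fun _ => bot_le)
      fun i => ?_
    rw [mul_comm, ← div_eq_mul_inv,
      ENNReal.le_div_iff_mul_le (.inl (weight_ne_zero k)) (.inl (weight_ne_top k)), mul_comm,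
      rho_eq]
    exact ENNReal.le_tsum k
  · intro h
    refine ENNReal.tendsto_nhds_zero.2 fun ε hε => ?_
    have hε2 : 0 < ε / 2 := ENNReal.half_pos hε.ne'
    obtain ⟨n, hn⟩ := (ENNReal.tendsto_nhds_zero.1 (ENNReal.tendsto_sum_nat_add
      (fun k : ℕ => ((2 : ℝ≥0∞) ^ (k + 1))⁻¹)
      (by rw [tsum_inv_two_pow_succ]; exact ENNReal.one_ne_top)) _ hε2).exists
    have hfin : Tendsto (fun i => ∑ k ∈ Finset.range n, weight k *
        hausdorffEDist ((P i).carrier ∩ ballClasses (k + 1) (k + 1 : ℕ))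
          (Q.carrier ∩ ballClasses (k + 1) (k + 1 : ℕ))) F (𝓝 0) := by
      have := tendsto_finsetSum (Finset.range n) fun k _ =>
        ENNReal.Tendsto.const_mul (h k) (.inr (weight_ne_top k))
      simpa using this
    filter_upwards [ENNReal.tendsto_nhds_zero.1 hfin _ hε2] with i hi
    set f : ℕ → ℝ≥0∞ := fun k => weight k *
      hausdorffEDist ((P i).carrier ∩ ballClasses (k + 1) (k + 1 : ℕ))
        (Q.carrier ∩ ballClasses (k + 1) (k + 1 : ℕ)) with hf
    have hle : ∀ k, f k ≤ ((2 : ℝ≥0∞) ^ (k + 1))⁻¹ := fun k =>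
      weight_mul_hausdorffEDist_le k (P i) Q
    calc rho (P i) Q = ∑' k, f k := rho_eq _ _
      _ = ∑ k ∈ Finset.range n, f k + ∑' k, f (k + n) :=
          (Summable.sum_add_tsum_nat_add' ENNReal.summable).symm
      _ ≤ ε / 2 + ε / 2 :=
          add_le_add hi ((ENNReal.tsum_le_tsum fun k => hle (k + n)).trans hn)
      _ = ε := ENNReal.add_halves ε

/-- Along an ultrafilter finer than `atTop`, a positive `liminf` excludes the limit `0`, so weak
convergence identifies `Q` with the ultrafilter limit. -/
theorem tendsto_nhds_of_weaklyConverges {P : ℕ → Pyramid} {Q : Pyramid}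
    (h : WeaklyConverges P Q) : Tendsto P atTop (𝓝 Q) := by
  rw [tendsto_iff_ultrafilter]
  intro U hU
  rw [tendsto_nhds_iff_hausdorffEDist]
  intro k
  refine tendsto_hausdorffEDist_of_ultrafilter (fun X => ⟨fun hX => (h.1 X hX).mono_left hU,
    fun hX => ?_⟩) (k + 1)
  by_contra hn
  obtain ⟨c, hc0, hc⟩ := exists_between (h.2 X hn)
  have h1 := (eventually_lt_of_lt_liminf hc).filter_mono hU
  obtain ⟨i, hi, hi'⟩ := (h1.and (ENNReal.tendsto_nhds_zero.1 hX c hc0)).exists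
  exact absurd hi' (not_le.2 hi)

theorem weaklyConverges_of_tendsto_nhds {P : ℕ → Pyramid} {Q : Pyramid}
    (h : Tendsto P atTop (𝓝 Q)) : WeaklyConverges P Q := by
  rw [tendsto_nhds_iff_hausdorffEDist] at h
  refine ⟨fun X hX => ENNReal.tendsto_nhds_zero.2 fun ε hε => ?_, fun X hX => ?_⟩
  · have hε2 : 0 < ε / 2 := ENNReal.half_pos hε.ne'
    obtain ⟨k, hk, X', hX', hp, hlt⟩ := exists_mem_ballClasses_prec_edist_lt X hε2
    obtain ⟨k, rfl⟩ := Nat.exists_eq_add_of_le' hk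
    filter_upwards [ENNReal.tendsto_nhds_zero.1 (h k) _ hε2] with n hn
    rw [hausdorffEDist_comm] at hn
    calc infEDist X (P n).carrier ≤ infEDist X' (P n).carrier + edist X X' :=
          infEDist_le_infEDist_add_edist
      _ ≤ ε / 2 + ε / 2 := by
          refine add_le_add (le_trans ?_ hn) hlt.le
          exact (infEDist_anti inter_subset_left).trans
            (infEDist_le_hausdorffEDist_of_mem ⟨Q.lower X hX X' hp, hX'⟩)
      _ = ε := ENNReal.add_halves ε
  · have hpos : 0 < infEDist X Q.carrier := by
      rw [infEDist_pos_iff_notMem_closure, Q.isClosed_carrier.closure_eq]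
      exact hX
    obtain ⟨c, hc0, hc⟩ := ENNReal.lt_iff_exists_nnreal_btwn.1 hpos
    -- One quarter is for passing from `X` to `X'`, two for the factor `2` of the transfer, and one
    -- for the Hausdorff distance of the slices.
    have hc4 : (0 : ℝ≥0∞) < c / 4 := ENNReal.div_pos hc0.ne' ENNReal.ofNat_ne_top
    obtain ⟨k, hk, X', hX', hp, hlt⟩ := exists_mem_ballClasses_prec_edist_lt X hc4
    obtain ⟨k, rfl⟩ := Nat.exists_eq_add_of_le' hk
    refine hc4.trans_le (le_liminf_of_le (by isBoundedDefault) ?_)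
    filter_upwards [ENNReal.tendsto_nhds_zero.1 (h k) _ hc4] with n hn
    by_contra hlt'
    rw [not_le] at hlt'
    refine absurd hc (not_lt.2 ?_)
    have h1 : infEDist X' Q.carrier ≤
        infEDist X' (Q.carrier ∩ ballClasses (k + 1) (k + 1 : ℕ)) := infEDist_anti inter_subset_left
    have h2 : infEDist X' ((P n).carrier ∩ ballClasses (k + 1) (k + 1 : ℕ)) ≤ 2 * (c / 4) :=
      ((P n).infEDist_inter_ballClasses_le hX' hp).trans (mul_le_mul_right hlt'.le 2)
    calc infEDist X Q.carrier ≤ infEDist X' Q.carrier + edist X X' :=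
          infEDist_le_infEDist_add_edist
      _ ≤ 2 * (c / 4) + c / 4 + c / 4 :=
          add_le_add (h1.trans (infEDist_le_infEDist_add_hausdorffEDist.trans
            (add_le_add h2 hn))) hlt.le
      _ = 4 * (c / 4) := by ring
      _ = c := ENNReal.mul_div_cancel four_ne_zero ENNReal.ofNat_ne_top

/-- The metric `rho` on pyramids. -/
noncomputable abbrev metricSpace : MetricSpace Pyramid :=
  EMetricSpace.toMetricSpace fun P Q => ne_top_of_le_ne_top ENNReal.one_ne_top (rho_le_one P Q)

theorem compactSpace : CompactSpace Pyramid := by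
  refine ⟨isCompact_iff_ultrafilter_le_nhds.2 fun U _ => ?_⟩
  obtain ⟨Q, hQ⟩ := exists_mem_carrier_iff_tendsto U
  exact ⟨Q, mem_univ _, tendsto_nhds_iff_hausdorffEDist.2
    fun k => tendsto_hausdorffEDist_of_ultrafilter (P := id) hQ (k + 1)⟩

end Topology

end Pyramid

theorem mainTheorem5 :
    ∃ m : MetricSpace Pyramid,
      (∀ P Q : Pyramid, edist P Q = Pyramid.rho P Q) ∧
      (∀ (P : ℕ → Pyramid) (Q : Pyramid),
        Pyramid.WeaklyConverges P Q ↔ Tendsto P atTop (𝓝 Q)) ∧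
      CompactSpace Pyramid :=
  ⟨Pyramid.metricSpace, Pyramid.edist_eq_rho,
    fun _ _ => ⟨Pyramid.tendsto_nhds_of_weaklyConverges, Pyramid.weaklyConverges_of_tendsto_nhds⟩,
    Pyramid.compactSpace⟩
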